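/- **Setting.** *Resource types* are $a ::= o \mid \vec a\multimap a$, where an intersection type $\vec a=\langle a_1,\dots,a_k\rangle$ ($k\ge 0$) is a list of resource types. A cartesian morphism $\langle a_1,\dots,a_k\rangle\to\langle b_1,\dots,b_l\rangle$ is $\langle\alpha;f_1,\dots,f_l\rangle$ with $\alpha:[l]\to[k]$ any function and $f_i:a_{\alpha(i)}\to b_i$; morphisms of resource types are $id_o$ and $f\multimap g:(\vec a\multimap a)\to(\vec b\multimap b)$ with $f:\vec b\to\vec a$, $g:a\to b$. The morphism is *ground* if all $f_i$ are identities, and a *permutation* if moreover $\alpha$ is bijective. Contexts are sequences $x_1:\vec a_1,\dots,x_n:\vec a_n$, $\otimes$ is pointwise concatenation, and context morphisms are sequences of morphisms. *Cartesian resource terms* are $s::=x\mid\lambda x^f.s\mid s\langle t_1,\dots,t_k\rangle$, typed by: $x_1:\langle\rangle,\dots,x_i:\langle a\rangle,\dots,x_n:\langle\rangle\vdash x_i:a$; if $\gamma,x:\vec b\vdash s:a$ and $f:\vec a\to\vec b$ then $\gamma\vdash\lambda x^f.s:\vec a\multimap a$; if $\gamma_0\vdash s:\vec a\multimap b$ and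 $\gamma_i\vdash t_i:a_i$ for all $i$ then $\gamma_0\otimes\gamma_1\otimes\cdots\otimes\gamma_k\vdash s\langle t_1,\dots,t_k\rangle:b$. *Actions.* A morphism $f:a\to b$ acts covariantly: $[f](\gamma\vdash s:a)=(\gamma'\vdash [f]s:b)$ with a context morphism $\mu:\gamma\to\gamma'$; it precomposes binder annotations ($[f\multimap g]\lambda x^h.s=\lambda x^{\mu_x h f}.[g]s$), acts by $[f](s\vec t)=([id\multimap f]s)\vec t$, retypes variables, and acts on bags by $[\langle\alpha;f_1,\dots,f_l\rangle]\langle t_1,\dots,t_k\rangle=\langle[f_1]t_{\alpha(1)},\dots,[f_l]t_{\alpha(l)}\rangle$. A morphism $\theta:\delta\to\gamma$ acts contravariantly: $(\gamma\vdash s:a)\{\theta\}=(\delta'\vdash s\{\theta\}:a')$ with $\nu:\delta\to\delta'$ and a residual morphism $h:a'\to a$; it retypes the variable occurrences, a variable retyped by $f$ acts covariantly through $f$ on the bags it is applied to, and $h$ is what remains of $f$ when there are too few such bags ($h$ is an identity on $\eta$-long terms). *Reduction.* Steps are labelled, $(\gamma\vdash s:a)\to_{\theta;f}(\gamma'\vdash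 s':a')$ with $\theta:\gamma\to\gamma'$ and $f:a'\to a$. *Exponential* reduction $\Rightarrow$ is the contextual closure of $\lambda x^f.s\Rightarrow_{\nu;\,\nu_x\multimap h}\lambda x^{id}.s\{id,f\}$, for $f$ not an identity; *linear* reduction $\Rrightarrow$ is the contextual closure of $(\lambda x^{\tau}.s)\vec t\Rrightarrow s\{[\tau]\vec t/x\}$ for $\tau$ a permutation, where linear substitution replaces the occurrences of $x$, from left to right, by the elements of the bag; its label is the induced morphism of contexts. In the closure, a reduction below $\lambda x^g$ that changes the context by $\theta_x$ at $x$ turns $g$ into $\theta_x g$; a reduction of the function part labelled $f\multimap h$ acts by $[f]$ on the bag; a reduction of the bag labelled $f$ acts by $[f\multimap id]$ on the function part; and one step in a bag reduces the elements at a nonempty set of positions in parallel. The isomorphism $\cong_\sigma$ is the least relation on typed terms that contains $(x:\langle a\rangle\vdash x:a)\cong_{id}(x:\langle a\rangle\vdash x:a)$ and $(\gamma\vdash s:a)\cong_\sigma(\gamma'\vdash s:a)$ for permutations $\sigma:\gamma\to\gamma'$ with both sides derivable, relates $\lambda x^f.s$ to $\lambda x^{\sigma f}.s'$ (with label $\theta$)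 when $s\cong_{\theta,\sigma}s'$, and is closed under application and bags. The approximation relation $s\lhd M$ between resource terms and $\lambda$-terms is generated by $x\lhd x$; $\lambda x^f.s\lhd\lambda x.M$ if $s\lhd M$; $s\langle t_1,\dots,t_k\rangle\lhd MN$ if $s\lhd M$ and $t_i\lhd N$ for all $i$. *Idempotent types* are $A::=o\mid\tilde A\Rightarrow B$ with $\tilde A=A_1\cap\dots\cap A_k$ a nonempty finite set of types. The rules are: $\Gamma\vdash x:A$ if $A\in\Gamma(x)$; $\Gamma\vdash\lambda x.M:\tilde A\Rightarrow B$ if $\Gamma,x:\tilde A\vdash M:B$; $\Gamma\vdash MN:B$ if $\Gamma\vdash M:\tilde A\Rightarrow B$ and $\Gamma\vdash N:A$ for every $A\in\tilde A$. Fix an enumeration of types, put $[\![o]\!]=o$, $[\![\tilde A\Rightarrow B]\!]=[\![\tilde A]\!]\multimap[\![B]\!]$, and let $[\![A_1\cap\dots\cap A_k]\!]$ be the list of the $[\![A_i]\!]$ in increasing order of the $A_i$. The *coarse approximation* $\lceil d\rceil$ of a derivation $d$ of $\Gamma\vdash M:A$ replaces each variable by itself, each argument $N$ typed with $\tilde A$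 by the bag of the coarse approximations of its derivations, in the order of $[\![\tilde A]\!]$, and annotates each binder $x:\tilde A$ with the canonical ground morphism from $[\![\tilde A]\!]$ to the list of the types of the occurrences of $x$ (a combination of $n$-ary contractions, weakenings and exchanges). Its context $\gamma_d$ lists the types of the occurrences of each free variable, and $\mathsf{cart}_d:[\![\Gamma]\!]\to\gamma_d$ is the canonical ground morphism. **Theorem.** 1. For every derivation $d$ of $\Gamma\vdash M:A$, $\gamma_d\vdash\lceil d\rceil:[\![A]\!]$, $\mathsf{cart}_d$ is a morphism $[\![\Gamma]\!]\to\gamma_d$, and $\lceil d\rceil\lhd M$. 2. Let $d$ be a derivation of $\Gamma\vdash M:A$ and let $M\to_\beta N$ be one step of $\beta$-reduction. Then there are a derivation $d'$ of $\Gamma\vdash N:A$, cartesian resource terms $\delta_1\vdash t_1:[\![A]\!]$ and $\delta_2\vdash t_2:[\![A]\!]$, ground morphisms $\nu:\gamma_d\to\delta_1$ and $\nu':\delta_1\to\delta_2$, and a permutation $\sigma:\delta_2\to\gamma_{d'}$ such that $$(\gamma_d\vdash\lceil d\rceil:[\![A]\!])\ \Rightarrow^{=}_{\nu;id}\ (\delta_1\vdash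 t_1:[\![A]\!])\ \Rrightarrow_{\nu';id}\ (\delta_2\vdash t_2:[\![A]\!])\ \cong_\sigma\ (\gamma_{d'}\vdash\lceil d'\rceil:[\![A]\!]),$$ where $\Rightarrow^{=}$ is at most one exponential step (none, i.e. $t_1=\lceil d\rceil$ and $\nu=id$, is possible only if the redexes to be contracted are already linear) and $\Rrightarrow$ is exactly one linear step. Moreover $\sigma\circ\nu'\circ\nu\circ\mathsf{cart}_d=\mathsf{cart}_{d'}$. 3. If $\Gamma\vdash M:A$ is derivable, then $M$ is strongly normalizing for $\beta$-reduction. 4. Every strongly normalizing $\lambda$-term $M$ has a derivation $d$ of some $\Gamma\vdash M:A$; so $M$ is represented by a typed cartesian resource term, namely $\gamma_d\vdash\lceil d\rceil:[\![A]\!]$ with $\lceil d\rceil\lhd M$. -/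

import Mathlib

namespace StructRes

/-! ### Resource types and their morphisms -/

/-- Resource types: `o` or `⟨a₁,…,aₖ⟩ ⊸ a`; an intersection type is a list of resource types. -/
inductive RTy : Type
  | o : RTy
  | arr : List RTy → RTy → RTy

/- Morphisms of resource types and of lists. The list morphism `⟨α; f₁,…,fₗ⟩ : src → tgt` is
`cons α(1) f₁ (… (cons α(l) fₗ (nil src)))`, positions being numbered from `0`; which of these raw
expressions are morphisms, and between which types, is said by `Mor.HasTy` and `LMor.HasTy`. -/
mutual
inductive Mor : Type
  | base : Mor
  | arr : LMor → Mor → Mor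
inductive LMor : Type
  | nil : List RTy → LMor
  | cons : ℕ → Mor → LMor → LMor
end

mutual
inductive Mor.HasTy : Mor → RTy → RTy → Prop
  | base : Mor.HasTy Mor.base RTy.o RTy.o
  | arr {f : LMor} {g : Mor} {as bs : List RTy} {a b : RTy} :
      LMor.HasTy f bs as → Mor.HasTy g a b → Mor.HasTy (Mor.arr f g) (RTy.arr as a) (RTy.arr bs b)
inductive LMor.HasTy : LMor → List RTy → List RTy → Prop
  | nil (as : List RTy) : LMor.HasTy (LMor.nil as) as []
  | cons {i : ℕ} {f : Mor} {g : LMor} {as bs : List RTy} {c b : RTy} :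
      as[i]? = some c → Mor.HasTy f c b → LMor.HasTy g as bs →
      LMor.HasTy (LMor.cons i f g) as (b :: bs)
end

/-- The source of a list morphism. -/
def LMor.src : LMor → List RTy
  | LMor.nil as => as
  | LMor.cons _ _ g => g.src

/-- The `j`-th component of a list morphism `⟨α; f⟩`: the pair `(α(j), f_j)`. -/
def LMor.get? : LMor → ℕ → Option (ℕ × Mor)
  | LMor.nil _, _ => none
  | LMor.cons i f _, 0 => some (i, f)
  | LMor.cons _ _ g, j + 1 => g.get? j

theorem LMor.get?_sizeOf : ∀ (f : LMor) (j i : ℕ) (k : Mor),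
    f.get? j = some (i, k) → sizeOf k < sizeOf f
  | LMor.nil _, j, i, k, h => by simp [LMor.get?] at h
  | LMor.cons i' f' g, 0, i, k, h => by
      simp only [LMor.get?, Option.some.injEq, Prod.mk.injEq] at h
      obtain ⟨_, rfl⟩ := h
      simp only [LMor.cons.sizeOf_spec]; omega
  | LMor.cons i' f' g, j + 1, i, k, h => by
      have := LMor.get?_sizeOf g j i k (by simpa [LMor.get?] using h)
      simp only [LMor.cons.sizeOf_spec]; omega

/- Composition: `g.comp f` is `g ∘ f`. (Meaningful when the types match; arbitrary otherwise.) -/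
mutual
def Mor.comp (g f : Mor) : Mor :=
  match g, f with
  | Mor.arr g₁ g₂, Mor.arr f₁ f₂ => Mor.arr (LMor.comp f₁ g₁) (Mor.comp g₂ f₂)
  | _, _ => Mor.base
termination_by sizeOf g + sizeOf f
decreasing_by all_goals simp only [Mor.arr.sizeOf_spec]; omega
def LMor.comp (g f : LMor) : LMor :=
  match g with
  | LMor.nil _ => LMor.nil f.src
  | LMor.cons j h g' =>
    match _hk : f.get? j with
    | some (i, k) => LMor.cons i (Mor.comp h k) (LMor.comp g' f)
    | none => LMor.comp g' f
termination_by sizeOf g + sizeOf f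
decreasing_by
  · have := LMor.get?_sizeOf f j i k _hk
    simp only [LMor.cons.sizeOf_spec]; omega
  · simp only [LMor.cons.sizeOf_spec]; omega
  · simp only [LMor.cons.sizeOf_spec]; omega
end

/- Identities. `idAux src k bs` is the part of the identity of `src` whose components are at the
positions `k, k+1, …`, these being of types `bs`. -/
mutual
def idM : RTy → Mor
  | RTy.o => Mor.base
  | RTy.arr as a => Mor.arr (idAux as 0 as) (idM a)
def idAux (src : List RTy) (k : ℕ) : List RTy → LMor
  | [] => LMor.nil src
  | b :: bs => LMor.cons k (idM b) (idAux src (k + 1) bs)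
end

/-- The identity of a list of types. -/
def idL (as : List RTy) : LMor := idAux as 0 as

/-- The list `as^[α]`, with `α` given as its list of values. -/
def reindex (as : List RTy) (α : List ℕ) : List RTy := α.map fun j => as.getD j RTy.o

/-- The ground morphism `⟨α; id,…,id⟩ : as → as^[α]`. -/
def ground (as : List RTy) : List ℕ → LMor
  | [] => LMor.nil as
  | j :: α => LMor.cons j (idM (as.getD j RTy.o)) (ground as α)

/-- `f` is a ground morphism from `as` to `bs`. -/
def IsGround (f : LMor) (as bs : List RTy) : Prop :=
  ∃ α : List ℕ, (∀ j ∈ α, j < as.length) ∧ f = ground as α ∧ bs = reindex as α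

/-- `f` is a permutation from `as` to `bs`: a ground morphism with bijective `α`. -/
def IsPerm (f : LMor) (as bs : List RTy) : Prop :=
  ∃ α : List ℕ, α.Perm (List.range as.length) ∧ f = ground as α ∧ bs = reindex as α

/-- Change of the source along a map of positions. -/
def LMor.mapIdx (σ : ℕ → ℕ) (src' : List RTy) : LMor → LMor
  | LMor.nil _ => LMor.nil src'
  | LMor.cons i f g => LMor.cons (σ i) f (g.mapIdx σ src')

/-- The pairing `⟨f, g⟩ : as → bs ⊕ cs` of `f : as → bs` and `g : as → cs`. -/
def LMor.pair : LMor → LMor → LMor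
  | LMor.nil _, g => g
  | LMor.cons i f r, g => LMor.cons i f (LMor.pair r g)

/-- The tensor product `f ⊕ g : as ⊕ bs → as' ⊕ bs'`. -/
def LMor.tensor (f g : LMor) : LMor :=
  (f.mapIdx id (f.src ++ g.src)).pair (g.mapIdx (· + f.src.length) (f.src ++ g.src))

/-- The permutation `(a₀ ⊕ a₁) ⊕ (d₀ ⊕ d₁) → (a₀ ⊕ d₀) ⊕ (a₁ ⊕ d₁)`. -/
def swapL (a₀ a₁ d₀ d₁ : List RTy) : LMor :=
  ground ((a₀ ++ a₁) ++ (d₀ ++ d₁))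
    ((List.range' 0 a₀.length ++ List.range' (a₀.length + a₁.length) d₀.length) ++
      (List.range' a₀.length a₁.length ++
        List.range' (a₀.length + a₁.length + d₀.length) d₁.length))

/-! ### Typing contexts -/

/-- Contexts `x₀ : a⃗₀, …, xₙ₋₁ : a⃗ₙ₋₁`; variables are de Bruijn indices. -/
abbrev Ctx (n : ℕ) := Fin n → List RTy

/-- Morphisms of contexts are sequences of morphisms of lists. -/
abbrev CMor (n : ℕ) := Fin n → LMor

variable {n : ℕ}

/-- Adding a (most recently bound) variable to a context, or a component to a morphism. -/
def ext {α : Type} (a : α) (γ : Fin n → α) : Fin (n + 1) → α :=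
  Fin.cons (α := fun _ => α) a γ

/-- The context in which every variable has the empty intersection type. -/
def Ctx.empty : Ctx n := fun _ => []

/-- The context `x₀ : ⟨⟩, …, xᵢ : ⟨a⟩, …, xₙ₋₁ : ⟨⟩`. -/
def single (i : Fin n) (a : RTy) : Ctx n := fun j => if j = i then [a] else []

/-- The tensor product of contexts. -/
def Ctx.tensor (γ δ : Ctx n) : Ctx n := fun i => γ i ++ δ i

def CMor.HasTy (θ : CMor n) (γ δ : Ctx n) : Prop := ∀ i, LMor.HasTy (θ i) (γ i) (δ i)
def CMor.IsGround (θ : CMor n) (γ δ : Ctx n) : Prop := ∀ i, StructRes.IsGround (θ i) (γ i) (δ i)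
def CMor.IsPerm (θ : CMor n) (γ δ : Ctx n) : Prop := ∀ i, StructRes.IsPerm (θ i) (γ i) (δ i)
def CMor.comp (η θ : CMor n) : CMor n := fun i => (η i).comp (θ i)
def CMor.tensor (η θ : CMor n) : CMor n := fun i => (η i).tensor (θ i)
def CMor.pair (η θ : CMor n) : CMor n := fun i => (η i).pair (θ i)
def idC (γ : Ctx n) : CMor n := fun i => idL (γ i)

/-- The terminal morphism `γ → (⟨⟩, …, ⟨⟩)`. -/
def termC (γ : Ctx n) : CMor n := fun i => LMor.nil (γ i)

/-- The projections `γ ⊗ δ → γ` and `γ ⊗ δ → δ`. -/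
def projL (γ δ : Ctx n) : CMor n := fun i =>
  ground (γ i ++ δ i) (List.range' 0 (γ i).length)
def projR (γ δ : Ctx n) : CMor n := fun i =>
  ground (γ i ++ δ i) (List.range' (γ i).length (δ i).length)

def swapC (γ₀ γ₁ δ₀ δ₁ : Ctx n) : CMor n := fun i => swapL (γ₀ i) (γ₁ i) (δ₀ i) (δ₁ i)

/-- The context morphism `δ → single i a` that is `⟨k; f⟩` at `xᵢ`, for `f` from the `k`-th type of
`δ i` to `a`. -/
def varMor (δ : Ctx n) (i : Fin n) (k : ℕ) (f : Mor) : CMor n := fun j =>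
  if j = i then LMor.cons k f (LMor.nil (δ j)) else LMor.nil (δ j)

/-! ### Structural (cartesian) resource terms -/

/- Terms `x | λx^f s | s t⃗` with at most `n` free variables, and bags. -/
mutual
inductive Tm : ℕ → Type
  | var {n : ℕ} : Fin n → Tm n
  | lam {n : ℕ} : LMor → Tm (n + 1) → Tm n
  | app {n : ℕ} : Tm n → Bag n → Tm n
inductive Bag : ℕ → Type
  | nil {n : ℕ} : Bag n
  | cons {n : ℕ} : Tm n → Bag n → Bag n
end

def liftRen {m n : ℕ} (ρ : Fin n → Fin m) : Fin (n + 1) → Fin (m + 1) :=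
  ext 0 (fun i => (ρ i).succ)

mutual
def Tm.rename : {n : ℕ} → Tm n → {m : ℕ} → (Fin n → Fin m) → Tm m
  | _, Tm.var i, _, ρ => Tm.var (ρ i)
  | _, Tm.lam f s, _, ρ => Tm.lam f (s.rename (liftRen ρ))
  | _, Tm.app s t, _, ρ => Tm.app (s.rename ρ) (t.rename ρ)
def Bag.rename : {n : ℕ} → Bag n → {m : ℕ} → (Fin n → Fin m) → Bag m
  | _, Bag.nil, _, _ => Bag.nil
  | _, Bag.cons s t, _, ρ => Bag.cons (s.rename ρ) (t.rename ρ)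
end

def Bag.append : Bag n → Bag n → Bag n
  | Bag.nil, t => t
  | Bag.cons s r, t => Bag.cons s (r.append t)

/- Typing of terms and of bags: `γ ⊢ s : a` and `γ ⊢_b t⃗ : a⃗`. -/
mutual
inductive HasType : {n : ℕ} → Ctx n → Tm n → RTy → Prop
  | var {n : ℕ} (i : Fin n) (a : RTy) : HasType (single i a) (Tm.var i) a
  | lam {n : ℕ} {γ : Ctx n} {s : Tm (n + 1)} {f : LMor} {as bs : List RTy} {a : RTy} :
      HasType (ext bs γ) s a → LMor.HasTy f as bs → HasType γ (Tm.lam f s) (RTy.arr as a)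
  | app {n : ℕ} {γ₀ γ₁ : Ctx n} {s : Tm n} {t : Bag n} {as : List RTy} {b : RTy} :
      HasType γ₀ s (RTy.arr as b) → HasBagType γ₁ t as →
      HasType (γ₀.tensor γ₁) (Tm.app s t) b
inductive HasBagType : {n : ℕ} → Ctx n → Bag n → List RTy → Prop
  | nil {n : ℕ} : HasBagType (Ctx.empty : Ctx n) Bag.nil []
  | cons {n : ℕ} {γ δ : Ctx n} {s : Tm n} {t : Bag n} {a : RTy} {as : List RTy} :
      HasType γ s a → HasBagType δ t as → HasBagType (γ.tensor δ) (Bag.cons s t) (a :: as)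
end

/-! ### Actions of type morphisms -/

/-- `BagGet δ q i γ ρ s`: the `i`-th element of the typed bag `δ ⊢_b q` is `γ ⊢ s`, and
`ρ : δ → γ` is the projection. -/
inductive BagGet : {n : ℕ} → Ctx n → Bag n → ℕ → Ctx n → CMor n → Tm n → Prop
  | zero {n : ℕ} {γ δ : Ctx n} {s : Tm n} {q : Bag n} {a : RTy} {as : List RTy} :
      HasType γ s a → HasBagType δ q as →
      BagGet (γ.tensor δ) (Bag.cons s q) 0 γ (projL γ δ) s
  | succ {n : ℕ} {γ δ γ' : Ctx n} {s s' : Tm n} {q : Bag n} {a : RTy} {i : ℕ} {ρ : CMor n} :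
      HasType γ s a → BagGet δ q i γ' ρ s' →
      BagGet (γ.tensor δ) (Bag.cons s q) (i + 1) γ' (ρ.comp (projR γ δ)) s'

/- The covariant action. `Cov γ s f γ' μ s'` says that `[f](γ ⊢ s : a)` is `γ' ⊢ s' : b`, where
`f : a → b` and `μ : γ → γ'`. -/
mutual
inductive Cov : {n : ℕ} → Ctx n → Tm n → Mor → Ctx n → CMor n → Tm n → Prop
  | var {n : ℕ} {i : Fin n} {a b : RTy} {f : Mor} :
      Mor.HasTy f a b →
      Cov (single i a) (Tm.var i) f (single i b) (varMor (single i a) i 0 f) (Tm.var i)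
  | lam {n : ℕ} {γ γ' : Ctx n} {cs cs' as bs : List RTy} {s s' : Tm (n + 1)} {h f : LMor}
      {g : Mor} {μ₀ : LMor} {μ : CMor n} :
      LMor.HasTy h as cs → LMor.HasTy f bs as →
      Cov (ext cs γ) s g (ext cs' γ') (ext μ₀ μ) s' →
      Cov γ (Tm.lam h s) (Mor.arr f g) γ' μ (Tm.lam ((μ₀.comp h).comp f) s')
  | app {n : ℕ} {γ₀ γ₁ γ₀' : Ctx n} {s s' : Tm n} {t : Bag n} {cs : List RTy} {f : Mor}
      {μ : CMor n} :
      HasBagType γ₁ t cs → Cov γ₀ s (Mor.arr (idL cs) f) γ₀' μ s' →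
      Cov (γ₀.tensor γ₁) (Tm.app s t) f (γ₀'.tensor γ₁) (μ.tensor (idC γ₁)) (Tm.app s' t)
inductive CovBag : {n : ℕ} → Ctx n → Bag n → LMor → Ctx n → CMor n → Bag n → Prop
  | nil {n : ℕ} {δ : Ctx n} {q : Bag n} {as : List RTy} :
      HasBagType δ q as → CovBag δ q (LMor.nil as) Ctx.empty (termC δ) Bag.nil
  | cons {n : ℕ} {δ γ γ' δ' : Ctx n} {q q' : Bag n} {s s' : Tm n} {i : ℕ} {f : Mor} {g : LMor}
      {ρ μ μ' : CMor n} :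
      BagGet δ q i γ ρ s → Cov γ s f γ' μ s' → CovBag δ q g δ' μ' q' →
      CovBag δ q (LMor.cons i f g) (γ'.tensor δ') ((μ.comp ρ).pair μ') (Bag.cons s' q')
end

/-- The morphism `⟨f⟩ ⊕ g : a ⊕ as → b ⊕ bs` for `f : a → b` and `g : as → bs`. -/
def consL (a : RTy) (f : Mor) (g : LMor) : LMor :=
  (LMor.cons 0 f (LMor.nil [a])).tensor g

/- The contravariant action. `Contra δ θ γ s δ' ν s' h` says that the action of `θ : δ → γ` on
`γ ⊢ s : a` is `δ' ⊢ s'`, with `ν : δ → δ'`. A variable acted on by `f : b → a` becomes a variable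
of type `b`, and `f` is handed over to the bags the variable is applied to. What is left of it,
because the variable has fewer arguments than its type allows, is the morphism `h` from the type of
`s'` to the type of `s`; on terms in η-long form `h` is an identity. -/
mutual
inductive Contra : {n : ℕ} → Ctx n → CMor n → Ctx n → Tm n →
    Ctx n → CMor n → Tm n → Mor → Prop
  | var {n : ℕ} {δ : Ctx n} {i : Fin n} {k : ℕ} {a b : RTy} {f : Mor} :
      (δ i)[k]? = some b → Mor.HasTy f b a →
      Contra δ (varMor δ i k f) (single i a) (Tm.var i)
        (single i b) (varMor δ i k (idM b)) (Tm.var i) f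
  | lam {n : ℕ} {γ δ δ' : Ctx n} {θ ν : CMor n} {as bs bs' : List RTy} {s s' : Tm (n + 1)}
      {f ν₀ : LMor} {h : Mor} :
      LMor.HasTy f as bs →
      Contra (ext bs δ) (ext (idL bs) θ) (ext bs γ) s (ext bs' δ') (ext ν₀ ν) s' h →
      Contra δ θ γ (Tm.lam f s) δ' ν (Tm.lam (ν₀.comp f) s') (Mor.arr (idL as) h)
  | app {n : ℕ} {γ₀ γ₁ δ δ₀ δ₁ δ₁' : Ctx n} {θ₀ θ₁ ν₀ ν₁ μ : CMor n} {s s' : Tm n}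
      {q q' q'' : Bag n} {h₁ k : LMor} {h₂ : Mor} :
      Contra δ θ₀ γ₀ s δ₀ ν₀ s' (Mor.arr h₁ h₂) → ContraBag δ θ₁ γ₁ q δ₁ ν₁ q' k →
      CovBag δ₁ q' (h₁.comp k) δ₁' μ q'' →
      Contra δ (θ₀.pair θ₁) (γ₀.tensor γ₁) (Tm.app s q)
        (δ₀.tensor δ₁') (ν₀.pair (μ.comp ν₁)) (Tm.app s' q'') h₂
inductive ContraBag : {n : ℕ} → Ctx n → CMor n → Ctx n → Bag n →
    Ctx n → CMor n → Bag n → LMor → Prop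
  | nil {n : ℕ} {δ : Ctx n} :
      ContraBag δ (termC δ) Ctx.empty Bag.nil Ctx.empty (termC δ) Bag.nil (LMor.nil [])
  | cons {n : ℕ} {γ₀ γ₁ δ δ₀ δ₁ : Ctx n} {θ₀ θ₁ ν₀ ν₁ : CMor n} {s s' : Tm n} {q q' : Bag n}
      {a' : RTy} {h : Mor} {k : LMor} :
      HasType δ₀ s' a' →
      Contra δ θ₀ γ₀ s δ₀ ν₀ s' h → ContraBag δ θ₁ γ₁ q δ₁ ν₁ q' k →
      ContraBag δ (θ₀.pair θ₁) (γ₀.tensor γ₁) (Bag.cons s q)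
        (δ₀.tensor δ₁) (ν₀.pair ν₁) (Bag.cons s' q') (consL a' h k)
end

/-! ### Linear substitution -/

/- `LSub k γ s δ t γ' σ s'`: substituting the bag `δ ⊢_b t` for the variable `k` in `γ ⊢ s`, its
occurrences being replaced from left to right by the elements of the bag, gives `γ' ⊢ s'`, where
`σ : (γ without k) ⊗ δ → γ'` is the permutation of the free variable occurrences. -/
mutual
inductive LSub : {n : ℕ} → Fin (n + 1) → Ctx (n + 1) → Tm (n + 1) → Ctx n → Bag n →
    Ctx n → CMor n → Tm n → Prop
  | var_eq {n : ℕ} {k : Fin (n + 1)} {δ : Ctx n} {t : Tm n} {a : RTy} :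
      HasType δ t a →
      LSub k (single k a) (Tm.var k) δ (Bag.cons t Bag.nil) δ (idC δ) t
  | var_ne {n : ℕ} {k : Fin (n + 1)} {i : Fin n} {a : RTy} :
      LSub k (single (k.succAbove i) a) (Tm.var (k.succAbove i)) Ctx.empty Bag.nil
        (single i a) (idC (single i a)) (Tm.var i)
  | lam {n : ℕ} {k : Fin (n + 1)} {γ : Ctx (n + 1)} {δ γ' : Ctx n} {as bs bs' : List RTy}
      {s : Tm (n + 2)} {s' : Tm (n + 1)} {t : Bag n} {f σ₀ : LMor} {σ : CMor n} :
      LMor.HasTy f as bs →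
      LSub k.succ (ext bs γ) s (ext [] δ) (t.rename Fin.succ) (ext bs' γ') (ext σ₀ σ) s' →
      LSub k γ (Tm.lam f s) δ t γ' σ (Tm.lam (σ₀.comp f) s')
  | app {n : ℕ} {k : Fin (n + 1)} {γ₀ γ₁ : Ctx (n + 1)} {δ₀ δ₁ γ₀' γ₁' : Ctx n}
      {s : Tm (n + 1)} {s' : Tm n} {q : Bag (n + 1)} {q' t₀ t₁ : Bag n} {σ₀ σ₁ : CMor n} :
      LSub k γ₀ s δ₀ t₀ γ₀' σ₀ s' → LSubBag k γ₁ q δ₁ t₁ γ₁' σ₁ q' →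
      LSub k (γ₀.tensor γ₁) (Tm.app s q) (δ₀.tensor δ₁) (t₀.append t₁) (γ₀'.tensor γ₁')
        ((σ₀.tensor σ₁).comp
          (swapC (fun i => γ₀ (k.succAbove i)) (fun i => γ₁ (k.succAbove i)) δ₀ δ₁))
        (Tm.app s' q')
inductive LSubBag : {n : ℕ} → Fin (n + 1) → Ctx (n + 1) → Bag (n + 1) → Ctx n → Bag n →
    Ctx n → CMor n → Bag n → Prop
  | nil {n : ℕ} {k : Fin (n + 1)} :
      LSubBag k Ctx.empty Bag.nil Ctx.empty Bag.nil Ctx.empty (idC Ctx.empty) Bag.nil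
  | cons {n : ℕ} {k : Fin (n + 1)} {γ₀ γ₁ : Ctx (n + 1)} {δ₀ δ₁ γ₀' γ₁' : Ctx n}
      {s : Tm (n + 1)} {s' : Tm n} {q : Bag (n + 1)} {q' t₀ t₁ : Bag n} {σ₀ σ₁ : CMor n} :
      LSub k γ₀ s δ₀ t₀ γ₀' σ₀ s' → LSubBag k γ₁ q δ₁ t₁ γ₁' σ₁ q' →
      LSubBag k (γ₀.tensor γ₁) (Bag.cons s q) (δ₀.tensor δ₁) (t₀.append t₁) (γ₀'.tensor γ₁')
        ((σ₀.tensor σ₁).comp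
          (swapC (fun i => γ₀ (k.succAbove i)) (fun i => γ₁ (k.succAbove i)) δ₀ δ₁))
        (Bag.cons s' q')
end

/-! ### Structural reduction -/

/-- Labelled relations `(γ ⊢ s : a) →_{θ; f} (γ' ⊢ s' : a')`, with `θ : γ → γ'`, `f : a' → a`;
the arguments are `γ s a θ f γ' s' a'`. -/
abbrev LRel := (n : ℕ) → Ctx n → Tm n → RTy → CMor n → Mor → Ctx n → Tm n → RTy → Prop

/-- The ground step of exponential reduction: a binder annotation that is not an identity acts on
the body, and becomes an identity. -/
inductive ExpRoot : LRel
  | mk {n : ℕ} {γ γ' : Ctx n} {as bs as' : List RTy} {a a' : RTy} {s s' : Tm (n + 1)} {f ν₀ : LMor}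
      {ν : CMor n} {h : Mor} :
      HasType (ext as γ) s a → LMor.HasTy f bs as → f ≠ idL bs →
      Contra (ext bs γ) (ext f (idC γ)) (ext as γ) s (ext as' γ') (ext ν₀ ν) s' h →
      HasType (ext as' γ') s' a' →
      ExpRoot n γ (Tm.lam f s) (RTy.arr bs a) ν (Mor.arr ν₀ h)
        γ' (Tm.lam (idL as') s') (RTy.arr as' a')

/-- The ground step of linear reduction: a redex whose annotation is a permutation is contracted by
linear substitution. -/
inductive LinRoot : LRel
  | mk {n : ℕ} {γ δ δ' γ' : Ctx n} {as bs : List RTy} {a : RTy} {s : Tm (n + 1)} {s' : Tm n}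
      {t t' : Bag n} {τ : LMor} {μ σ : CMor n} :
      HasType (ext as γ) s a → IsPerm τ bs as → HasBagType δ t bs →
      CovBag δ t τ δ' μ t' → LSub 0 (ext as γ) s δ' t' γ' σ s' →
      LinRoot n (γ.tensor δ) (Tm.app (Tm.lam τ s) t) a
        (σ.comp ((idC γ).tensor μ)) (idM a) γ' s' a

/- Contextual closure of a ground step. One step in a bag reduces the elements of a nonempty set of
positions, in parallel. -/
mutual
inductive Step (R : LRel) :
    (n : ℕ) → Ctx n → Tm n → RTy → CMor n → Mor → Ctx n → Tm n → RTy → Prop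
  | root {n : ℕ} {γ γ' : Ctx n} {s s' : Tm n} {a a' : RTy} {θ : CMor n} {f : Mor} :
      R n γ s a θ f γ' s' a' → Step R n γ s a θ f γ' s' a'
  | lam {n : ℕ} {γ γ' : Ctx n} {as as' bs : List RTy} {s s' : Tm (n + 1)} {a a' : RTy} {θ₀ g : LMor}
      {θ : CMor n} {f : Mor} :
      Step R (n + 1) (ext as γ) s a (ext θ₀ θ) f (ext as' γ') s' a' → LMor.HasTy g bs as →
      Step R n γ (Tm.lam g s) (RTy.arr bs a) θ (Mor.arr (idL bs) f)
        γ' (Tm.lam (θ₀.comp g) s') (RTy.arr bs a')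
  | appL {n : ℕ} {γ γ' δ δ' : Ctx n} {s s' : Tm n} {t t' : Bag n} {as as' : List RTy} {b b' : RTy}
      {θ μ : CMor n} {f : LMor} {h : Mor} :
      Step R n γ s (RTy.arr as b) θ (Mor.arr f h) γ' s' (RTy.arr as' b') →
      HasBagType δ t as → CovBag δ t f δ' μ t' →
      Step R n (γ.tensor δ) (Tm.app s t) b (θ.tensor μ) h (γ'.tensor δ') (Tm.app s' t') b'
  | appR {n : ℕ} {γ γ' δ δ' : Ctx n} {s s' : Tm n} {t t' : Bag n} {as as' : List RTy} {b : RTy}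
      {θ μ : CMor n} {f : LMor} :
      BagStep R n δ t as θ f δ' t' as' →
      HasType γ s (RTy.arr as b) → Cov γ s (Mor.arr f (idM b)) γ' μ s' →
      Step R n (γ.tensor δ) (Tm.app s t) b (μ.tensor θ) (idM b) (γ'.tensor δ') (Tm.app s' t') b
inductive BagStep (R : LRel) :
    (n : ℕ) → Ctx n → Bag n → List RTy → CMor n → LMor → Ctx n → Bag n → List RTy → Prop
  | head {n : ℕ} {γ γ' δ : Ctx n} {s s' : Tm n} {t : Bag n} {a a' : RTy} {as : List RTy}
      {θ : CMor n} {f : Mor} :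
      Step R n γ s a θ f γ' s' a' → HasBagType δ t as →
      BagStep R n (γ.tensor δ) (Bag.cons s t) (a :: as) (θ.tensor (idC δ)) (consL a' f (idL as))
        (γ'.tensor δ) (Bag.cons s' t) (a' :: as)
  | tail {n : ℕ} {γ δ δ' : Ctx n} {s : Tm n} {t t' : Bag n} {a : RTy} {as as' : List RTy}
      {θ : CMor n} {f : LMor} :
      HasType γ s a → BagStep R n δ t as θ f δ' t' as' →
      BagStep R n (γ.tensor δ) (Bag.cons s t) (a :: as) ((idC γ).tensor θ) (consL a (idM a) f)
        (γ.tensor δ') (Bag.cons s t') (a :: as')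
  | both {n : ℕ} {γ γ' δ δ' : Ctx n} {s s' : Tm n} {t t' : Bag n} {a a' : RTy} {as as' : List RTy}
      {θ θ' : CMor n} {f : Mor} {f' : LMor} :
      Step R n γ s a θ f γ' s' a' → BagStep R n δ t as θ' f' δ' t' as' →
      BagStep R n (γ.tensor δ) (Bag.cons s t) (a :: as) (θ.tensor θ') (consL a' f f')
        (γ'.tensor δ') (Bag.cons s' t') (a' :: as')
end

/-- One step of exponential reduction. -/
abbrev ExpStep : LRel := Step ExpRoot

/-- One step of linear reduction. -/
abbrev LinStep : LRel := Step LinRoot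

/-- At most one step of exponential reduction. -/
inductive ExpStepOpt : LRel
  | refl {n : ℕ} {γ : Ctx n} {s : Tm n} {a : RTy} : ExpStepOpt n γ s a (idC γ) (idM a) γ s a
  | step {n : ℕ} {γ γ' : Ctx n} {s s' : Tm n} {a a' : RTy} {θ : CMor n} {f : Mor} :
      ExpStep n γ s a θ f γ' s' a' → ExpStepOpt n γ s a θ f γ' s' a'

/-! ### Isomorphism of resource terms -/

/- `Iso γ s a θ γ' s'` is `(γ ⊢ s : a) ≅_θ (γ' ⊢ s' : a)`. -/
mutual
inductive Iso : {n : ℕ} → Ctx n → Tm n → RTy → CMor n → Ctx n → Tm n → Prop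
  | var {n : ℕ} (i : Fin n) (a : RTy) :
      Iso (single i a) (Tm.var i) a (idC (single i a)) (single i a) (Tm.var i)
  | perm {n : ℕ} {γ γ' : Ctx n} {s : Tm n} {a : RTy} {σ : CMor n} :
      HasType γ s a → HasType γ' s a → σ.IsPerm γ γ' → Iso γ s a σ γ' s
  | lam {n : ℕ} {γ γ' : Ctx n} {as as' bs : List RTy} {s s' : Tm (n + 1)} {a : RTy} {σ f : LMor}
      {θ : CMor n} :
      Iso (ext as γ) s a (ext σ θ) (ext as' γ') s' → LMor.HasTy f bs as →
      Iso γ (Tm.lam f s) (RTy.arr bs a) θ γ' (Tm.lam (σ.comp f) s')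
  | app {n : ℕ} {γ₀ γ₁ γ₀' γ₁' : Ctx n} {s s' : Tm n} {t t' : Bag n} {as : List RTy} {a : RTy}
      {θ₀ θ₁ : CMor n} :
      Iso γ₀ s (RTy.arr as a) θ₀ γ₀' s' → IsoBag γ₁ t as θ₁ γ₁' t' →
      Iso (γ₀.tensor γ₁) (Tm.app s t) a (θ₀.tensor θ₁) (γ₀'.tensor γ₁') (Tm.app s' t')
inductive IsoBag : {n : ℕ} → Ctx n → Bag n → List RTy → CMor n → Ctx n → Bag n → Prop
  | nil {n : ℕ} : IsoBag (Ctx.empty : Ctx n) Bag.nil [] (idC Ctx.empty) Ctx.empty Bag.nil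
  | cons {n : ℕ} {γ₀ γ₁ γ₀' γ₁' : Ctx n} {s s' : Tm n} {t t' : Bag n} {a : RTy} {as : List RTy}
      {θ₀ θ₁ : CMor n} :
      Iso γ₀ s a θ₀ γ₀' s' → IsoBag γ₁ t as θ₁ γ₁' t' →
      IsoBag (γ₀.tensor γ₁) (Bag.cons s t) (a :: as) (θ₀.tensor θ₁) (γ₀'.tensor γ₁')
        (Bag.cons s' t')
end

/-! ### Ordinary λ-terms -/

/-- λ-terms with at most `n` free variables. -/
inductive Lam : ℕ → Type
  | var {n : ℕ} : Fin n → Lam n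
  | lam {n : ℕ} : Lam (n + 1) → Lam n
  | app {n : ℕ} : Lam n → Lam n → Lam n

def Lam.rename : {n : ℕ} → Lam n → {m : ℕ} → (Fin n → Fin m) → Lam m
  | _, Lam.var i, _, ρ => Lam.var (ρ i)
  | _, Lam.lam M, _, ρ => Lam.lam (M.rename (liftRen ρ))
  | _, Lam.app M N, _, ρ => Lam.app (M.rename ρ) (N.rename ρ)

/-- Capture-avoiding simultaneous substitution. -/
def Lam.subst : {n : ℕ} → Lam n → {m : ℕ} → (Fin n → Lam m) → Lam m
  | _, Lam.var i, _, σ => σ i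
  | _, Lam.lam M, _, σ => Lam.lam (M.subst (ext (Lam.var 0) fun i => (σ i).rename Fin.succ))
  | _, Lam.app M N, _, σ => Lam.app (M.subst σ) (N.subst σ)

/-- `M{N/x₀}`. -/
def Lam.inst (M : Lam (n + 1)) (N : Lam n) : Lam n := M.subst (ext N Lam.var)

/-- One step of β-reduction. -/
inductive Beta : {n : ℕ} → Lam n → Lam n → Prop
  | beta {n : ℕ} (M : Lam (n + 1)) (N : Lam n) : Beta (Lam.app (Lam.lam M) N) (M.inst N)
  | lam {n : ℕ} {M M' : Lam (n + 1)} : Beta M M' → Beta (Lam.lam M) (Lam.lam M')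
  | appL {n : ℕ} {M M' N : Lam n} : Beta M M' → Beta (Lam.app M N) (Lam.app M' N)
  | appR {n : ℕ} {M N N' : Lam n} : Beta N N' → Beta (Lam.app M N) (Lam.app M N')

/-- There is no infinite β-reduction sequence from `M`. -/
def SN (M : Lam n) : Prop := ¬ ∃ u : ℕ → Lam n, u 0 = M ∧ ∀ i, Beta (u i) (u (i + 1))

/- The approximation relation between resource terms (bags) and λ-terms. -/
mutual
inductive Approx : {n : ℕ} → Tm n → Lam n → Prop
  | var {n : ℕ} (i : Fin n) : Approx (Tm.var i) (Lam.var i)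
  | lam {n : ℕ} {f : LMor} {s : Tm (n + 1)} {M : Lam (n + 1)} :
      Approx s M → Approx (Tm.lam f s) (Lam.lam M)
  | app {n : ℕ} {s : Tm n} {t : Bag n} {M N : Lam n} :
      Approx s M → ApproxBag t N → Approx (Tm.app s t) (Lam.app M N)
inductive ApproxBag : {n : ℕ} → Bag n → Lam n → Prop
  | nil {n : ℕ} {M : Lam n} : ApproxBag Bag.nil M
  | cons {n : ℕ} {s : Tm n} {t : Bag n} {M : Lam n} :
      Approx s M → ApproxBag t M → ApproxBag (Bag.cons s t) M
end

/-! ### Idempotent intersection types -/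

/-- Expressions `o` and `(A₁ ∩ ⋯ ∩ Aₖ) ⇒ B`. The idempotent types are those satisfying `IsIdem`. -/
inductive ITy : Type
  | o : ITy
  | arr : List ITy → ITy → ITy

/-- The idempotent intersection types, for a fixed enumeration of types: each intersection is a
nonempty finite set of types, represented by its list in increasing order of the enumeration. -/
inductive IsIdem (enum : ITy → ℕ) : ITy → Prop
  | o : IsIdem enum ITy.o
  | arr {As : List ITy} {B : ITy} :
      As ≠ [] → (∀ A ∈ As, IsIdem enum A) → As.Pairwise (fun A A' => enum A < enum A') →
      IsIdem enum B → IsIdem enum (ITy.arr As B)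

/-- Nonempty finite intersections of idempotent types. -/
def IsInter (enum : ITy → ℕ) (As : List ITy) : Prop :=
  As ≠ [] ∧ (∀ A ∈ As, IsIdem enum A) ∧ As.Pairwise (fun A A' => enum A < enum A')

/- Derivations of `Γ ⊢ M : A` and of `Γ ⊢_∩ M : A₁ ∩ ⋯ ∩ Aₖ`. -/
mutual
inductive Der (enum : ITy → ℕ) : {n : ℕ} → (Fin n → List ITy) → Lam n → ITy → Type
  | var {n : ℕ} {Γ : Fin n → List ITy} (i : Fin n) (j : ℕ) {A : ITy} (hA : (Γ i)[j]? = some A) :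
      Der enum Γ (Lam.var i) A
  | lam {n : ℕ} {Γ : Fin n → List ITy} {As : List ITy} {M : Lam (n + 1)} {B : ITy}
      (hAs : IsInter enum As) (d : Der enum (ext As Γ) M B) :
      Der enum Γ (Lam.lam M) (ITy.arr As B)
  | app {n : ℕ} {Γ : Fin n → List ITy} {As : List ITy} {M N : Lam n} {B : ITy}
      (d : Der enum Γ M (ITy.arr As B)) (e : DerI enum Γ N As) : Der enum Γ (Lam.app M N) B
inductive DerI (enum : ITy → ℕ) : {n : ℕ} → (Fin n → List ITy) → Lam n → List ITy → Type
  | nil {n : ℕ} {Γ : Fin n → List ITy} {M : Lam n} : DerI enum Γ M []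
  | cons {n : ℕ} {Γ : Fin n → List ITy} {M : Lam n} {A : ITy} {As : List ITy}
      (d : Der enum Γ M A) (e : DerI enum Γ M As) : DerI enum Γ M (A :: As)
end

/-! ### Coarse approximations -/

/- The translation `⟦·⟧` of types. -/
mutual
def trTy : ITy → RTy
  | ITy.o => RTy.o
  | ITy.arr As B => RTy.arr (trList As) (trTy B)
def trList : List ITy → List RTy
  | [] => []
  | A :: As => trTy A :: trList As
end

variable {enum : ITy → ℕ}

/- `occ d i` lists, from left to right, the occurrences of the variable `xᵢ` in the derivation `d`;
each is recorded as the position, in the intersection `Γ i`, of the type that it is given. -/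
mutual
def Der.occ : {n : ℕ} → {Γ : Fin n → List ITy} → {M : Lam n} → {A : ITy} →
    Der enum Γ M A → Fin n → List ℕ
  | _, _, _, _, Der.var i j _ => fun k => if k = i then [j] else []
  | _, _, _, _, Der.lam _ d => fun k => Der.occ d k.succ
  | _, _, _, _, Der.app d e => fun k => Der.occ d k ++ DerI.occ e k
def DerI.occ : {n : ℕ} → {Γ : Fin n → List ITy} → {M : Lam n} → {As : List ITy} →
    DerI enum Γ M As → Fin n → List ℕ
  | _, _, _, _, DerI.nil => fun _ => []
  | _, _, _, _, DerI.cons d e => fun k => Der.occ d k ++ DerI.occ e k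
end

/- The coarse approximation of a derivation. A binder `x : A₁ ∩ ⋯ ∩ Aₖ` is annotated with the
canonical ground morphism from `⟨⟦A₁⟧, …, ⟦Aₖ⟧⟩` to the list of the types of the occurrences of
`x`. -/
mutual
def Der.coarse : {n : ℕ} → {Γ : Fin n → List ITy} → {M : Lam n} → {A : ITy} →
    Der enum Γ M A → Tm n
  | _, _, _, _, Der.var i _ _ => Tm.var i
  | _, _, _, _, Der.lam (As := As) _ d => Tm.lam (ground (trList As) (Der.occ d 0)) (Der.coarse d)
  | _, _, _, _, Der.app d e => Tm.app (Der.coarse d) (DerI.coarse e)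
def DerI.coarse : {n : ℕ} → {Γ : Fin n → List ITy} → {M : Lam n} → {As : List ITy} →
    DerI enum Γ M As → Bag n
  | _, _, _, _, DerI.nil => Bag.nil
  | _, _, _, _, DerI.cons d e => Bag.cons (Der.coarse d) (DerI.coarse e)
end

/-- The context of the coarse approximation: for each variable, the list of the types of its
occurrences. -/
def Der.ctx {Γ : Fin n → List ITy} {M : Lam n} {A : ITy} (d : Der enum Γ M A) : Ctx n :=
  fun i => reindex (trList (Γ i)) (d.occ i)

/-- The canonical ground morphism from `⟦Γ⟧` to the context of the coarse approximation. -/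
def Der.cart {Γ : Fin n → List ITy} {M : Lam n} {A : ITy} (d : Der enum Γ M A) : CMor n :=
  fun i => ground (trList (Γ i)) (d.occ i)

end StructRes

open StructRes

namespace StructRes

/-! ### Algebra of morphisms -/

-- The coarse approximation of a derivation records, at each occurrence of a variable, which member
-- of its intersection is used there. All labels in the simulation are ground, so the work is
-- bookkeeping on lists of positions. `OccMor` keeps the index map of a ground morphism together
-- with the position lists that it relates. Composing it with the canonical morphism for the first
-- list then gives the canonical one for the second (`OccMor.comp_ground`), which yields both the
-- right annotations under binders and the equation between the `cart` morphisms.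
--
-- Consider the approximation of a redex `(λx.M)N`. Its bag has one element for each type in the
-- intersection of `x`, and the binder annotation says which element each occurrence of `x` wants. A
-- ground morphism acting contravariantly leaves a term unchanged (`HasType.contra_ground`), so the
-- exponential step only moves the annotation from the binder to the bag, where it copies, discards
-- and permutes (`Family.covBag`). The bag then has one element per occurrence, in the order of the
-- occurrences, and linear substitution grafts at each occurrence the derivation of `N` for the type
-- chosen there (`Der.exists_subst`). The result is literally the coarse approximation of a
-- derivation of the contractum, so the final isomorphism can be an identity. If the annotation is
-- already an identity, the exponential step is omitted. A β-step in an argument is followed in all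
-- elements of its bag in parallel; intersections being nonempty, at least one linear step takes
-- place.
--
-- Strong normalization of typable terms does not use the simulation. It is a reducibility argument
-- (`red_props`, `Typ.red`), in which nonempty intersections ensure that every argument is itself
-- typed.
--
-- Conversely, all subterms of a strongly normalizing term are typable (`BetaAcc.typable_subterm`),
-- by induction on accessibility and then on the subterm. Abstractions and terms headed by a
-- variable are typed from their parts. A term with a head redex is typed by subject expansion from
-- its contractum (`WeakHead.expand`), a subterm of a reduct of the whole term; the argument of the
-- redex is a smaller subterm, so it has a type even when the contraction erases it.

theorem idAux_get? (src : List RTy) : ∀ (bs : List RTy) (k j : ℕ) (c : RTy),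
    bs[j]? = some c → (idAux src k bs).get? j = some (k + j, idM c)
  | [], k, j, c, h => by simp at h
  | b :: bs, k, 0, c, h => by
      simp only [List.getElem?_cons_zero, Option.some.injEq] at h
      simp [idAux, LMor.get?, h]
  | b :: bs, k, j + 1, c, h => by
      simp only [List.getElem?_cons_succ] at h
      simp [idAux, LMor.get?, idAux_get? src bs (k + 1) j c h]
      omega

@[simp] theorem idAux_src (src : List RTy) : ∀ (bs : List RTy) (k : ℕ), (idAux src k bs).src = src
  | [], k => by simp [idAux, LMor.src]
  | b :: bs, k => by simp [idAux, LMor.src, idAux_src src bs]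

theorem LMor.comp_nil (as : List RTy) (f : LMor) : (LMor.nil as).comp f = LMor.nil f.src := by
  rw [LMor.comp]

theorem LMor.comp_cons {j i : ℕ} {h k : Mor} {g f : LMor} (hk : f.get? j = some (i, k)) :
    (LMor.cons j h g).comp f = LMor.cons i (h.comp k) (g.comp f) := by
  rw [LMor.comp]
  split
  · rename_i i' k' h'
    rw [hk] at h'
    simp only [Option.some.injEq, Prod.mk.injEq] at h'
    rw [h'.1, h'.2]
  · rename_i h'
    rw [hk] at h'
    simp at h'

theorem Mor.comp_base : Mor.base.comp Mor.base = Mor.base := by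
  rw [Mor.comp]; intros; simp_all

theorem Mor.comp_arr (g₁ f₁ : LMor) (g₂ f₂ : Mor) :
    (Mor.arr g₁ g₂).comp (Mor.arr f₁ f₂) = Mor.arr (f₁.comp g₁) (g₂.comp f₂) := by
  rw [Mor.comp]

theorem idM_arr (as : List RTy) (a : RTy) : idM (RTy.arr as a) = Mor.arr (idL as) (idM a) := by
  rw [idM, idL]

mutual
theorem Mor.HasTy.comp_id : ∀ {f : Mor} {a b : RTy}, Mor.HasTy f a b →
    (idM b).comp f = f ∧ f.comp (idM a) = f
  | _, _, _, .base => by simp [idM, Mor.comp_base]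
  | _, _, _, .arr h₁ h₂ => by
      have e₁ := LMor.HasTy.comp_id h₁
      have e₂ := Mor.HasTy.comp_id h₂
      simp only [idM_arr, Mor.comp_arr, e₂.1, e₂.2, e₁.2]
      rw [idL, e₁.1 _ _ _ (by simp) rfl]
      simp
-- The recursion peels components off the identity while the morphism composed with it stays whole.
-- Hence the auxiliary `f`, whose components from position `k` on are those of `g`.
theorem LMor.HasTy.comp_id : ∀ {g : LMor} {as bs : List RTy}, LMor.HasTy g as bs →
    (∀ (f : LMor) (k : ℕ) (src : List RTy), (∀ j, f.get? (k + j) = g.get? j) → f.src = g.src →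
      (idAux src k bs).comp f = g) ∧ g.comp (idL as) = g
  | _, _, _, .nil as => by
      refine ⟨fun f k src _ h => ?_, ?_⟩
      · rw [idAux, LMor.comp_nil, h, LMor.src]
      · rw [LMor.comp_nil, idL, idAux_src]
  | _, _, _, .cons (i := i) (f := f') (g := g') hi h₁ h₂ => by
      have e₁ := Mor.HasTy.comp_id h₁
      have e₂ := LMor.HasTy.comp_id h₂
      refine ⟨fun f k src hg hs => ?_, ?_⟩
      · rw [idAux, LMor.comp_cons (i := i) (k := f') (by simpa [LMor.get?] using hg 0), e₁.1,
          e₂.1 f (k + 1) src (fun j => ?_) (by simpa [LMor.src] using hs)]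
        have := hg (j + 1)
        rw [LMor.get?] at this
        rw [← this]; congr 1; omega
      · have e := e₂.2
        rw [idL] at e ⊢
        rw [LMor.comp_cons (idAux_get? _ _ 0 i _ hi), e₁.2, e]
        simp
end

theorem LMor.HasTy.id_comp {f : LMor} {as bs : List RTy} (h : LMor.HasTy f as bs) :
    (idL bs).comp f = f := h.comp_id.1 f 0 bs (by simp) rfl

theorem LMor.HasTy.comp_idL {f : LMor} {as bs : List RTy} (h : LMor.HasTy f as bs) :
    f.comp (idL as) = f := h.comp_id.2

mutual
theorem idM_hasTy : ∀ a : RTy, Mor.HasTy (idM a) a a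
  | RTy.o => by rw [idM]; exact .base
  | RTy.arr as a => by
      rw [idM]
      exact .arr (idAux_hasTy as as 0 (by simp)) (idM_hasTy a)
theorem idAux_hasTy : ∀ (bs src : List RTy) (k : ℕ), (∀ j, src[k + j]? = bs[j]?) →
    LMor.HasTy (idAux src k bs) src bs
  | [], src, k, h => by rw [idAux]; exact .nil _
  | b :: bs, src, k, h => by
      rw [idAux]
      refine .cons (by simpa using h 0) (idM_hasTy b) (idAux_hasTy bs src (k + 1) fun j => ?_)
      have := h (j + 1)
      rw [List.getElem?_cons_succ] at this
      rw [← this]; congr 1; omega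
end

theorem idL_hasTy (as : List RTy) : LMor.HasTy (idL as) as as := idAux_hasTy as as 0 (by simp)

theorem idM_comp_idM (a : RTy) : (idM a).comp (idM a) = idM a := (idM_hasTy a).comp_id.1

/-! ### Ground morphisms -/

@[simp] theorem ground_src (as : List RTy) : ∀ α : List ℕ, (ground as α).src = as
  | [] => rfl
  | _ :: α => by simp [ground, LMor.src, ground_src as α]

theorem ground_get? (as : List RTy) : ∀ (α : List ℕ) (j : ℕ), j < α.length →
    (ground as α).get? j = some (α.getD j 0, idM (as.getD (α.getD j 0) RTy.o))
  | [], j, h => by simp at h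
  | i :: α, 0, h => by simp [ground, LMor.get?]
  | i :: α, j + 1, h => by
      simp only [List.length_cons, Nat.add_lt_add_iff_right] at h
      simp [ground, LMor.get?, ground_get? as α j h]

theorem ground_hasTy (as : List RTy) : ∀ α : List ℕ, (∀ j ∈ α, j < as.length) →
    LMor.HasTy (ground as α) as (reindex as α)
  | [], _ => .nil _
  | i :: α, h => by
      have hi := h i (by simp)
      refine .cons ?_ (idM_hasTy _) (ground_hasTy as α fun j hj => h j (by simp [hj]))
      simp [hi]

theorem idAux_eq_ground (src : List RTy) : ∀ (bs : List RTy) (k : ℕ),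
    (∀ j, src[k + j]? = bs[j]?) → idAux src k bs = ground src (List.range' k bs.length)
  | [], k, h => by simp [idAux, ground]
  | b :: bs, k, h => by
      have h0 := h 0
      simp only [add_zero, List.getElem?_cons_zero] at h0
      rw [idAux, List.length_cons, List.range'_succ, ground, idAux_eq_ground src bs (k + 1)]
      · simp [h0]
      · intro j
        have := h (j + 1)
        rw [List.getElem?_cons_succ] at this
        rw [← this]; congr 1; omega

theorem idL_eq_ground (as : List RTy) : idL as = ground as (List.range as.length) := by
  rw [idL, idAux_eq_ground _ _ _ (by simp), List.range_eq_range']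

/-- A window of consecutive positions selects a segment. The two projections of a concatenation are
the cases where the left or the right part is empty. -/
theorem reindex_range' (as bs cs : List RTy) :
    reindex (as ++ bs ++ cs) (List.range' as.length bs.length) = bs := by
  apply List.ext_getElem
  · simp [reindex]
  · intro i h₁ h₂
    simp [reindex, List.append_assoc, List.getElem?_append_right, List.getElem?_append_left h₂, h₂]

theorem reindex_range (as : List RTy) : reindex as (List.range as.length) = as := by
  simpa [List.range_eq_range'] using reindex_range' [] as []

@[simp] theorem reindex_append (as : List RTy) (α β : List ℕ) :
    reindex as (α ++ β) = reindex as α ++ reindex as β := by simp [reindex]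

@[simp] theorem reindex_nil (as : List RTy) : reindex as [] = [] := rfl

@[simp] theorem reindex_length (as : List RTy) (α : List ℕ) :
    (reindex as α).length = α.length := by simp [reindex]

/-- Reindexing of lists of positions. -/
def rx (l α : List ℕ) : List ℕ := α.map fun j => l.getD j 0

@[simp] theorem rx_nil (l : List ℕ) : rx l [] = [] := rfl

@[simp] theorem rx_length (l α : List ℕ) : (rx l α).length = α.length := by simp [rx]

@[simp] theorem rx_append (l α β : List ℕ) : rx l (α ++ β) = rx l α ++ rx l β := by simp [rx]

theorem rx_range' (as bs cs : List ℕ) :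
    rx (as ++ bs ++ cs) (List.range' as.length bs.length) = bs := by
  apply List.ext_getElem
  · simp [rx]
  · intro i h₁ h₂
    simp [rx, List.append_assoc, List.getElem?_append_right, List.getElem?_append_left h₂, h₂]

theorem rx_range (l : List ℕ) : rx l (List.range l.length) = l := by
  simpa [List.range_eq_range'] using rx_range' [] l []

theorem rx_bound {l α : List ℕ} {m : ℕ} (hl : ∀ j ∈ l, j < m) (hα : ∀ j ∈ α, j < l.length) :
    ∀ j ∈ rx l α, j < m := by
  intro j hj
  simp only [rx, List.mem_map] at hj
  obtain ⟨i, hi, rfl⟩ := hj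
  have := hα i hi
  apply hl
  simp [this]

theorem reindex_reindex (as : List RTy) (l α : List ℕ) (hα : ∀ j ∈ α, j < l.length) :
    reindex (reindex as l) α = reindex as (rx l α) := by
  simp only [reindex, rx, List.map_map]
  apply List.map_congr_left
  intro j hj
  have := hα j hj
  simp [this]

theorem rx_rx (k l α : List ℕ) (hα : ∀ j ∈ α, j < l.length) : rx (rx k l) α = rx k (rx l α) := by
  simp only [rx, List.map_map]
  apply List.map_congr_left
  intro j hj
  have := hα j hj
  simp [this]

/-- All components are identities, so only the index lists compose. The bound on `α` avoids the junk
branch of `LMor.comp`, which drops a component. -/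
theorem ground_comp (as : List RTy) (l : List ℕ) : ∀ α : List ℕ, (∀ j ∈ α, j < l.length) →
    (ground (reindex as l) α).comp (ground as l) = ground as (rx l α)
  | [], _ => by simp [ground, rx, LMor.comp_nil]
  | i :: α, h => by
      have hi := h i (by simp)
      rw [ground, LMor.comp_cons (ground_get? as l i hi),
        ground_comp as l α fun j hj => h j (by simp [hj])]
      have : (reindex as l).getD i RTy.o = as.getD (l.getD i 0) RTy.o := by
        simp [reindex, hi]
      rw [this, idM_comp_idM]
      rfl

theorem ground_pair (as : List RTy) : ∀ α β : List ℕ,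
    (ground as α).pair (ground as β) = ground as (α ++ β)
  | [], _ => rfl
  | _ :: α, β => by simp [ground, LMor.pair, ground_pair as α β]

theorem ground_mapIdx (as bs : List RTy) (σ : ℕ → ℕ) : ∀ α : List ℕ,
    (∀ j ∈ α, bs.getD (σ j) RTy.o = as.getD j RTy.o) →
    (ground as α).mapIdx σ bs = ground bs (α.map σ)
  | [], _ => rfl
  | i :: α, h => by
      simp only [ground, LMor.mapIdx, List.map_cons]
      rw [ground_mapIdx as bs σ α fun j hj => h j (by simp [hj]), h i (by simp)]

/-- Only `α` needs a bound: an index beyond `as` would read from `bs` after concatenation, whereas a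
shifted index of `β` reads the same entry or the same default. -/
theorem ground_tensor (as bs : List RTy) (α β : List ℕ) (hα : ∀ j ∈ α, j < as.length)
    : (ground as α).tensor (ground bs β) =
      ground (as ++ bs) (α ++ β.map (· + as.length)) := by
  simp only [LMor.tensor, ground_src]
  rw [ground_mapIdx, ground_mapIdx, ground_pair]
  · simp
  · intro j hj
    simp [List.getElem?_append_right]
  · intro j hj
    simp [List.getElem?_append_left (hα j hj)]

theorem ground_injective (as : List RTy) : ∀ α β : List ℕ, ground as α = ground as β → α = β
  | [], [], _ => rfl
  | [], _ :: _, h => by simp [ground] at h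
  | _ :: _, [], h => by simp [ground] at h
  | i :: α, j :: β, h => by
      simp only [ground, LMor.cons.injEq] at h
      rw [h.1, ground_injective as α β h.2.2]

theorem idL_tensor (as bs : List RTy) : (idL as).tensor (idL bs) = idL (as ++ bs) := by
  rw [idL_eq_ground, idL_eq_ground, idL_eq_ground, ground_tensor _ _ _ _ (by simp)]
  congr 1
  rw [List.length_append, List.range_add]
  simp [Nat.add_comm]

theorem consL_id (a : RTy) (as : List RTy) : consL a (idM a) (idL as) = idL (a :: as) := by
  rw [consL, show LMor.cons 0 (idM a) (LMor.nil [a]) = idL [a] by simp [idL, idAux], idL_tensor]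
  rfl

theorem IsGround.hasTy {f : LMor} {as bs : List RTy} (h : IsGround f as bs) :
    LMor.HasTy f as bs := by
  obtain ⟨α, hα, rfl, rfl⟩ := h
  exact ground_hasTy as α hα

theorem IsGround.id (as : List RTy) : IsGround (idL as) as as :=
  ⟨List.range as.length, by simp, idL_eq_ground as, (reindex_range as).symm⟩

theorem IsGround.comp {f g : LMor} {as bs cs : List RTy} (hg : IsGround g bs cs)
    (hf : IsGround f as bs) : IsGround (g.comp f) as cs := by
  obtain ⟨α, hα, rfl, rfl⟩ := hf
  obtain ⟨β, hβ, rfl, rfl⟩ := hg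
  rw [reindex_length] at hβ
  exact ⟨rx α β, rx_bound hα hβ, ground_comp as α β hβ, reindex_reindex as α β hβ⟩

theorem IsGround.comp_assoc {f g h : LMor} {as bs cs ds : List RTy} (hh : IsGround h cs ds)
    (hg : IsGround g bs cs) (hf : IsGround f as bs) : (h.comp g).comp f = h.comp (g.comp f) := by
  obtain ⟨α, hα, rfl, rfl⟩ := hf
  obtain ⟨β, hβ, rfl, rfl⟩ := hg
  obtain ⟨γ, hγ, rfl, rfl⟩ := hh
  simp only [reindex_length] at hβ hγ
  rw [ground_comp _ _ _ hγ, ground_comp _ _ _ hβ, ground_comp _ _ _ (rx_bound hβ hγ),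
    reindex_reindex _ _ _ hβ, ground_comp _ _ _ (by simpa using hγ), rx_rx _ _ _ hγ]

theorem IsGround.projL (as bs : List RTy) :
    IsGround (ground (as ++ bs) (List.range' 0 as.length)) (as ++ bs) as :=
  ⟨_, by simp only [List.mem_range'_1, List.length_append]; omega, rfl,
    by simpa using (reindex_range' [] as bs).symm⟩

theorem IsGround.projR (as bs : List RTy) :
    IsGround (ground (as ++ bs) (List.range' as.length bs.length)) (as ++ bs) bs :=
  ⟨_, by simp only [List.mem_range'_1, List.length_append]; omega, rfl,
    by simpa using (reindex_range' as bs []).symm⟩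

/-- Composing with a projection cuts the index list down to its initial or final segment, and
pairing concatenates the two segments again. -/
theorem IsGround.pair_proj {f : LMor} {cs as bs : List RTy} (h : IsGround f cs (as ++ bs)) :
    ((ground (as ++ bs) (List.range' 0 as.length)).comp f).pair
      ((ground (as ++ bs) (List.range' as.length bs.length)).comp f) = f := by
  obtain ⟨α, hα, rfl, e⟩ := h
  have hl : as.length + bs.length = α.length := by
    rw [← List.length_append, e, reindex_length]
  rw [e, ground_comp, ground_comp, ground_pair, ← rx_append]
  · congr 1
    have : List.range' 0 as.length ++ List.range' as.length bs.length = List.range α.length := by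
      rw [List.range_eq_range', ← hl, ← List.range'_append]; simp
    rw [this, rx_range]
  · intro j; simp only [List.mem_range'_1]; omega
  · intro j; simp only [List.mem_range'_1]; omega

/-- The rules of the contravariant action at applications and bags only apply to labels presented as
pairings. -/
theorem IsGround.split {f : LMor} {cs as bs : List RTy} (h : IsGround f cs (as ++ bs)) :
    ∃ f₀ f₁, f = LMor.pair f₀ f₁ ∧ IsGround f₀ cs as ∧ IsGround f₁ cs bs :=
  ⟨_, _, h.pair_proj.symm, (IsGround.projL as bs).comp h, (IsGround.projR as bs).comp h⟩

theorem IsGround.eq_nil {f : LMor} {as : List RTy} (h : IsGround f as []) : f = LMor.nil as := by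
  obtain ⟨α, -, rfl, e⟩ := h
  have : α = [] := by simpa [reindex] using e
  rw [this]; rfl

/-! ### Ground morphisms between lists of occurrences -/

/-- `f` is the ground morphism from `as^[l]` to `as^[l']` induced by a map of the positions of `l'`
to the positions of `l`. -/
def OccMor (as : List RTy) (l l' : List ℕ) (f : LMor) : Prop :=
  ∃ α : List ℕ, (∀ j ∈ α, j < l.length) ∧ l' = rx l α ∧ f = ground (reindex as l) α

namespace OccMor
variable {as : List RTy} {l l' l'' : List ℕ} {f g : LMor}

theorem isGround (h : OccMor as l l' f) : StructRes.IsGround f (reindex as l) (reindex as l') := by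
  obtain ⟨α, hα, rfl, rfl⟩ := h
  exact ⟨α, by simpa using hα, rfl, (reindex_reindex as l α hα).symm⟩

theorem id (as : List RTy) (l : List ℕ) : OccMor as l l (idL (reindex as l)) :=
  ⟨List.range l.length, by simp, (rx_range l).symm, by rw [idL_eq_ground, reindex_length]⟩

theorem comp (hg : OccMor as l' l'' g) (hf : OccMor as l l' f) : OccMor as l l'' (g.comp f) := by
  obtain ⟨α, hα, rfl, rfl⟩ := hf
  obtain ⟨β, hβ, rfl, rfl⟩ := hg
  rw [rx_length] at hβ
  refine ⟨rx α β, rx_bound hα hβ, rx_rx _ _ _ hβ, ?_⟩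
  rw [← reindex_reindex _ _ _ hα, ground_comp _ _ _ hβ]

theorem pair (hf : OccMor as l l' f) (hg : OccMor as l l'' g) :
    OccMor as l (l' ++ l'') (f.pair g) := by
  obtain ⟨α, hα, rfl, rfl⟩ := hf
  obtain ⟨β, hβ, rfl, rfl⟩ := hg
  refine ⟨α ++ β, ?_, by simp, ground_pair _ _ _⟩
  simp only [List.mem_append]
  rintro j (h | h)
  exacts [hα j h, hβ j h]

theorem tensor {k k' : List ℕ} (hf : OccMor as l l' f) (hg : OccMor as k k' g) :
    OccMor as (l ++ k) (l' ++ k') (f.tensor g) := by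
  obtain ⟨α, hα, rfl, rfl⟩ := hf
  obtain ⟨β, hβ, rfl, rfl⟩ := hg
  refine ⟨α ++ β.map (· + l.length), ?_, ?_, ?_⟩
  · simp only [List.mem_append, List.mem_map, List.length_append]
    rintro j (h | ⟨i, h, rfl⟩)
    · have := hα j h; omega
    · have := hβ i h; omega
  · rw [rx_append]
    congr 1
    · apply List.map_congr_left
      intro j hj
      simp [List.getElem?_append_left (hα j hj)]
    · simp only [rx, List.map_map]
      apply List.map_congr_left
      intro j hj
      simp [List.getElem?_append_right]
  · rw [ground_tensor _ _ _ _ (by simpa using hα), reindex_append, reindex_length]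

theorem of_range' (as : List RTy) (k l m : List ℕ) :
    OccMor as (k ++ l ++ m) l (ground (reindex as (k ++ l ++ m)) (List.range' k.length l.length)) :=
  ⟨_, by simp only [List.mem_range'_1, List.length_append]; omega, (rx_range' k l m).symm, rfl⟩

theorem projL (as : List RTy) (l m : List ℕ) : OccMor as (l ++ m) l
    (ground (reindex as l ++ reindex as m) (List.range' 0 (reindex as l).length)) := by
  simpa using of_range' as [] l m

theorem projR (as : List RTy) (l m : List ℕ) : OccMor as (l ++ m) m
    (ground (reindex as l ++ reindex as m)
      (List.range' (reindex as l).length (reindex as m).length)) := by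
  simpa using of_range' as l m []

theorem swap (as : List RTy) (a₀ a₁ d₀ d₁ : List ℕ) :
    OccMor as (a₀ ++ a₁ ++ (d₀ ++ d₁)) (a₀ ++ d₀ ++ (a₁ ++ d₁))
      (swapL (reindex as a₀) (reindex as a₁) (reindex as d₀) (reindex as d₁)) := by
  have h₁ := of_range' as [] a₀ (a₁ ++ (d₀ ++ d₁))
  have h₂ := of_range' as (a₀ ++ a₁) d₀ d₁
  have h₃ := of_range' as a₀ a₁ (d₀ ++ d₁)
  have h₄ := of_range' as (a₀ ++ a₁ ++ d₀) d₁ []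
  simp only [List.nil_append, List.append_assoc, List.append_nil] at h₁ h₂ h₃ h₄ ⊢
  have := (h₁.pair h₂).pair (h₃.pair h₄)
  simp only [ground_pair, List.append_assoc] at this
  simpa [swapL, Nat.add_assoc] using this

/-- This is the reason for relating positions and not just types: when types repeat in `as`, an
arbitrary ground morphism between the type lists could exchange two positions of equal type, and the
composite would no longer be canonical. -/
theorem comp_ground (h : OccMor as l l' f) : f.comp (ground as l) = ground as l' := by
  obtain ⟨α, hα, rfl, rfl⟩ := h
  exact ground_comp _ _ _ hα

end OccMor

variable {n : ℕ}

/-! ### Contexts -/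

@[simp] theorem ext_zero {α : Type} (a : α) (γ : Fin n → α) : ext a γ 0 = a := rfl

@[simp] theorem ext_succ {α : Type} (a : α) (γ : Fin n → α) (i : Fin n) : ext a γ i.succ = γ i :=
  rfl

theorem ext_eta {α : Type} (γ : Fin (n + 1) → α) : ext (γ 0) (fun i => γ i.succ) = γ := by
  funext i; refine Fin.cases rfl (fun i => rfl) i

theorem idC_ext (as : List RTy) (γ : Ctx n) : idC (ext as γ) = ext (idL as) (idC γ) := by
  funext i; refine Fin.cases rfl (fun i => rfl) i

theorem idC_tensor (γ δ : Ctx n) : (idC γ).tensor (idC δ) = idC (γ.tensor δ) := by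
  funext i; exact idL_tensor _ _

theorem varMor_single_id (i : Fin n) (a : RTy) :
    varMor (single i a) i 0 (idM a) = idC (single i a) := by
  funext j
  by_cases h : j = i <;> simp [varMor, idC, single, h, idL, idAux]

theorem CMor.IsGround.id (γ : Ctx n) : (idC γ).IsGround γ γ := fun i => StructRes.IsGround.id (γ i)

theorem CMor.IsGround.id_comp {θ : CMor n} {γ δ : Ctx n} (h : θ.IsGround γ δ) :
    (idC δ).comp θ = θ := by
  funext i; exact (h i).hasTy.id_comp

theorem CMor.IsGround.comp {η θ : CMor n} {γ δ ε : Ctx n} (hη : η.IsGround δ ε)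
    (hθ : θ.IsGround γ δ) : (η.comp θ).IsGround γ ε := fun i => (hη i).comp (hθ i)

theorem CMor.IsGround.projL (γ δ : Ctx n) : (projL γ δ).IsGround (γ.tensor δ) γ :=
  fun i => StructRes.IsGround.projL (γ i) (δ i)

theorem CMor.IsGround.projR (γ δ : Ctx n) : (projR γ δ).IsGround (γ.tensor δ) δ :=
  fun i => StructRes.IsGround.projR (γ i) (δ i)

theorem CMor.IsGround.ext {f : LMor} {θ : CMor n} {as bs : List RTy} {γ δ : Ctx n}
    (hf : StructRes.IsGround f as bs) (hθ : θ.IsGround γ δ) :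
    CMor.IsGround (ext f θ) (ext as γ) (ext bs δ) := by
  intro i; refine Fin.cases hf hθ i

theorem CMor.IsGround.split {θ : CMor n} {δ γ₀ γ₁ : Ctx n} (h : θ.IsGround δ (γ₀.tensor γ₁)) :
    ∃ θ₀ θ₁ : CMor n, θ = θ₀.pair θ₁ ∧ θ₀.IsGround δ γ₀ ∧ θ₁.IsGround δ γ₁ := by
  choose f₀ f₁ h₁ h₂ h₃ using fun i => (h i).split
  exact ⟨f₀, f₁, funext h₁, h₂, h₃⟩

theorem CMor.IsGround.eq_termC {θ : CMor n} {δ : Ctx n} (h : θ.IsGround δ Ctx.empty) :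
    θ = termC δ := by
  funext i; exact (h i).eq_nil

/-- The target has one type in all, so there is one index, at `i`, and terminal morphisms elsewhere.
This is the shape required by the variable rule of the contravariant action. -/
theorem CMor.IsGround.eq_varMor {θ : CMor n} {δ : Ctx n} {i : Fin n} {a : RTy}
    (h : θ.IsGround δ (single i a)) : ∃ k, (δ i)[k]? = some a ∧ θ = varMor δ i k (idM a) := by
  obtain ⟨α, hα, e₁, e₂⟩ := h i
  have hl : α.length = 1 := by simpa [single] using (congrArg List.length e₂).symm
  obtain ⟨k, rfl⟩ := List.length_eq_one_iff.1 hl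
  have hk := hα k (by simp)
  have ha : a = (δ i).getD k RTy.o := by simpa [single, reindex] using e₂
  refine ⟨k, by simp [ha, hk], ?_⟩
  funext j
  by_cases hj : j = i
  · subst hj
    rw [e₁, ha]
    simp [varMor, ground]
  · have := h j
    simp only [single, hj, if_false] at this
    rw [this.eq_nil]
    simp [varMor, hj]

/-! ### Actions of identities and of ground morphisms -/

theorem BagGet.isGround : ∀ {n : ℕ} {δ γ : Ctx n} {q : Bag n} {i : ℕ} {ρ : CMor n} {s : Tm n},
    BagGet δ q i γ ρ s → ρ.IsGround δ γ
  | _, _, _, _, _, _, _, .zero _ _ => CMor.IsGround.projL _ _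
  | _, _, _, _, _, _, _, .succ _ h => h.isGround.comp (CMor.IsGround.projR _ _)

mutual
theorem HasType.cov_id : ∀ {n : ℕ} {γ : Ctx n} {s : Tm n} {a : RTy}, HasType γ s a →
    Cov γ s (idM a) γ (idC γ) s
  | _, _, _, _, .var i a => by
      have := Cov.var (i := i) (idM_hasTy a)
      rwa [varMor_single_id] at this
  | _, _, _, _, .lam (s := s) (γ := γ) (f := f) (as := as) (bs := bs) (a := a) h hf => by
      have ih := h.cov_id
      rw [idC_ext] at ih
      have := Cov.lam hf (idL_hasTy as) ih
      rwa [hf.id_comp, hf.comp_idL, ← idM_arr] at this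
  | _, _, _, _, .app hs ht => by
      have ih := hs.cov_id
      rw [idM_arr] at ih
      have := Cov.app ht ih
      rwa [idC_tensor] at this
-- Here `q` is thought of as the part of the ambient bag `q₀` from position `k` on, with `π` the
-- projection onto its context. The recursion shortens `q`, but the action always looks its elements
-- up in `q₀`.
theorem HasBagType.cov_idAux : ∀ {n : ℕ} {δ : Ctx n} {q : Bag n} {as : List RTy},
    HasBagType δ q as → ∀ {δ₀ : Ctx n} {q₀ : Bag n} {src : List RTy} (k : ℕ) {π : CMor n},
    HasBagType δ₀ q₀ src → π.IsGround δ₀ δ →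
    (∀ j γ ρ s, BagGet δ q j γ ρ s → BagGet δ₀ q₀ (k + j) γ (ρ.comp π) s) →
    CovBag δ₀ q₀ (idAux src k as) δ π q
  | _, _, _, _, .nil, δ₀, q₀, src, k, π, h₀, hπ, _ => by
      rw [hπ.eq_termC, idAux]
      exact .nil h₀
  | _, _, _, _, .cons (γ := γ) (δ := δ) hs ht, δ₀, q₀, src, k, π, h₀, hπ, hg => by
      rw [idAux]
      have h₁ := hg 0 _ _ _ (.zero hs ht)
      have h₂ := ht.cov_idAux (k + 1) h₀ ((CMor.IsGround.projR γ δ).comp hπ) fun j γ' ρ s' h => by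
        have := hg (j + 1) _ _ _ (.succ hs h)
        have e : (ρ.comp (projR γ δ)).comp π = ρ.comp ((projR γ δ).comp π) := by
          funext i
          exact (h.isGround i).comp_assoc (StructRes.IsGround.projR _ _) (hπ i)
        rw [e] at this
        rwa [Nat.add_assoc, Nat.add_comm 1 j]
      have := CovBag.cons h₁ hs.cov_id h₂
      rw [((CMor.IsGround.projL γ δ).comp hπ).id_comp] at this
      have e : ((projL γ δ).comp π).pair ((projR γ δ).comp π) = π := by
        funext i
        exact (hπ i).pair_proj
      rwa [e] at this
end

theorem HasBagType.cov_id {δ : Ctx n} {q : Bag n} {as : List RTy} (h : HasBagType δ q as) :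
    CovBag δ q (idL as) δ (idC δ) q :=
  h.cov_idAux 0 h (CMor.IsGround.id δ) fun j γ ρ s hg => by
    have e : ρ.comp (idC δ) = ρ := by
      funext i
      exact (hg.isGround i).hasTy.comp_idL
    rwa [e, Nat.zero_add]

mutual
-- The components of `θ` are identities, so no variable changes its type and nothing is handed to
-- the bags or left over; the whole of `θ` survives as the label. An exponential step with ground
-- annotation therefore does not touch the body.
theorem HasType.contra_ground : ∀ {n : ℕ} {γ : Ctx n} {s : Tm n} {a : RTy}, HasType γ s a →
    ∀ {δ : Ctx n} {θ : CMor n}, θ.IsGround δ γ → Contra δ θ γ s γ θ s (idM a)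
  | _, _, _, _, .var i a, δ, θ, hθ => by
      obtain ⟨k, hk, rfl⟩ := hθ.eq_varMor
      exact .var hk (idM_hasTy a)
  | _, _, _, _, .lam h hf, δ, θ, hθ => by
      have := Contra.lam hf (h.contra_ground (CMor.IsGround.ext (StructRes.IsGround.id _) hθ))
      rwa [hf.id_comp, ← idM_arr] at this
  | _, _, _, _, .app hs ht, δ, θ, hθ => by
      obtain ⟨θ₀, θ₁, rfl, h₀, h₁⟩ := hθ.split
      have ih := hs.contra_ground h₀
      rw [idM_arr] at ih
      have hc := ht.cov_id
      -- `Contra.app` acts on the bag by the residual of the function part composed with that of the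
      -- bag; both are identities here.
      rw [← (idL_hasTy _).id_comp] at hc
      have := Contra.app ih (ht.contra_ground h₁) hc
      rwa [h₁.id_comp] at this
theorem HasBagType.contra_ground : ∀ {n : ℕ} {γ : Ctx n} {q : Bag n} {as : List RTy},
    HasBagType γ q as →
    ∀ {δ : Ctx n} {θ : CMor n}, θ.IsGround δ γ → ContraBag δ θ γ q γ θ q (idL as)
  | _, _, _, _, .nil, δ, θ, hθ => by
      rw [hθ.eq_termC]
      exact .nil
  | _, _, _, _, .cons hs ht, δ, θ, hθ => by
      obtain ⟨θ₀, θ₁, rfl, h₀, h₁⟩ := hθ.split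
      have := ContraBag.cons hs (hs.contra_ground h₀) (ht.contra_ground h₁)
      rwa [consL_id] at this
end

variable {enum : ITy → ℕ}

/-! ### Coarse approximations -/

theorem trList_eq_map : ∀ As : List ITy, trList As = As.map trTy
  | [] => rfl
  | A :: As => by rw [trList, trList_eq_map As, List.map_cons]

/-- The context given by lists of occurrences, recorded as positions in `Γ`. -/
def occCtx (Γ : Fin n → List ITy) (o : Fin n → List ℕ) : Ctx n :=
  fun i => reindex (trList (Γ i)) (o i)

/-- `θ` is the morphism of contexts induced by maps of occurrences. -/
def CMor.Occ (Γ : Fin n → List ITy) (o o' : Fin n → List ℕ) (θ : CMor n) : Prop :=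
  ∀ i, OccMor (trList (Γ i)) (o i) (o' i) (θ i)

theorem occCtx_ext (As : List ITy) (Γ : Fin n → List ITy) (l : List ℕ) (o : Fin n → List ℕ) :
    occCtx (ext As Γ) (ext l o) = ext (reindex (trList As) l) (occCtx Γ o) := by
  funext i; refine Fin.cases rfl (fun i => rfl) i

theorem occCtx_append (Γ : Fin n → List ITy) (o o' : Fin n → List ℕ) :
    occCtx Γ (fun i => o i ++ o' i) = (occCtx Γ o).tensor (occCtx Γ o') := by
  funext i; simp [occCtx, Ctx.tensor]

namespace CMor.Occ
variable {Γ : Fin n → List ITy} {o o' o'' p p' : Fin n → List ℕ} {θ η : CMor n}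

theorem isGround (h : Occ Γ o o' θ) : θ.IsGround (occCtx Γ o) (occCtx Γ o') :=
  fun i => (h i).isGround

theorem id (Γ : Fin n → List ITy) (o : Fin n → List ℕ) : Occ Γ o o (idC (occCtx Γ o)) :=
  fun _ => OccMor.id _ _

theorem comp (hη : Occ Γ o' o'' η) (hθ : Occ Γ o o' θ) : Occ Γ o o'' (η.comp θ) :=
  fun i => (hη i).comp (hθ i)

theorem tensor (hη : Occ Γ o o' η) (hθ : Occ Γ p p' θ) :
    Occ Γ (fun i => o i ++ p i) (fun i => o' i ++ p' i) (η.tensor θ) :=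
  fun i => (hη i).tensor (hθ i)

theorem pair (hη : Occ Γ o o' η) (hθ : Occ Γ o o'' θ) :
    Occ Γ o (fun i => o' i ++ o'' i) (η.pair θ) :=
  fun i => (hη i).pair (hθ i)

theorem projL (Γ : Fin n → List ITy) (o p : Fin n → List ℕ) :
    Occ Γ (fun i => o i ++ p i) o (projL (occCtx Γ o) (occCtx Γ p)) :=
  fun _ => OccMor.projL _ _ _

theorem projR (Γ : Fin n → List ITy) (o p : Fin n → List ℕ) :
    Occ Γ (fun i => o i ++ p i) p (projR (occCtx Γ o) (occCtx Γ p)) :=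
  fun _ => OccMor.projR _ _ _

theorem swap (Γ : Fin n → List ITy) (a₀ a₁ d₀ d₁ : Fin n → List ℕ) :
    Occ Γ (fun i => a₀ i ++ a₁ i ++ (d₀ i ++ d₁ i)) (fun i => a₀ i ++ d₀ i ++ (a₁ i ++ d₁ i))
      (swapC (occCtx Γ a₀) (occCtx Γ a₁) (occCtx Γ d₀) (occCtx Γ d₁)) :=
  fun _ => OccMor.swap _ _ _ _ _

theorem termC (Γ : Fin n → List ITy) (o : Fin n → List ℕ) :
    Occ Γ o (fun _ => []) (termC (occCtx Γ o)) :=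
  fun _ => ⟨[], by simp, rfl, rfl⟩

end CMor.Occ

/-- The context of the coarse approximation of the derivations for an argument. -/
def DerI.ctx {Γ : Fin n → List ITy} {M : Lam n} {As : List ITy} (e : DerI enum Γ M As) : Ctx n :=
  occCtx Γ e.occ

theorem Der.ctx_eq {Γ : Fin n → List ITy} {M : Lam n} {A : ITy} (d : Der enum Γ M A) :
    d.ctx = occCtx Γ d.occ := rfl

theorem Der.ctx_var {Γ : Fin n → List ITy} {i : Fin n} {j : ℕ} {A : ITy}
    (h : (Γ i)[j]? = some A) :
    (Der.var (enum := enum) i j h).ctx = single i (trTy A) := by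
  funext k
  by_cases hk : k = i
  · subst hk
    simp [Der.ctx, Der.occ, single, reindex, trList_eq_map, h]
  · simp [Der.ctx, Der.occ, single, hk]

theorem Der.ctx_lam {Γ : Fin n → List ITy} {As : List ITy} {M : Lam (n + 1)} {B : ITy}
    (d : Der enum (ext As Γ) M B) :
    d.ctx = ext (reindex (trList As) (d.occ 0)) (occCtx Γ fun i => d.occ i.succ) := by
  rw [← occCtx_ext, ext_eta]; rfl

theorem Der.ctx_app {Γ : Fin n → List ITy} {As : List ITy} {M N : Lam n} {B : ITy}
    (d : Der enum Γ M (ITy.arr As B)) (e : DerI enum Γ N As) :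
    (Der.app d e).ctx = d.ctx.tensor e.ctx := occCtx_append _ _ _

theorem DerI.ctx_cons {Γ : Fin n → List ITy} {M : Lam n} {A : ITy} {As : List ITy}
    (d : Der enum Γ M A) (e : DerI enum Γ M As) :
    (DerI.cons d e).ctx = d.ctx.tensor e.ctx := occCtx_append _ _ _

mutual
theorem Der.occ_lt : ∀ {n : ℕ} {Γ : Fin n → List ITy} {M : Lam n} {A : ITy}
    (d : Der enum Γ M A) (k : Fin n), ∀ j ∈ d.occ k, j < (Γ k).length
  | _, _, _, _, .var i j h, k => by
      intro l hl
      by_cases hk : k = i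
      · subst hk
        obtain rfl : l = j := by simpa [Der.occ] using hl
        by_contra hlt
        simp [List.getElem?_eq_none (not_lt.1 hlt)] at h
      · simp [Der.occ, hk] at hl
  | _, _, _, _, .lam _ d, k => d.occ_lt k.succ
  | _, _, _, _, .app d e, k => by
      intro j hj
      rw [Der.occ, List.mem_append] at hj
      exact hj.elim (d.occ_lt k j) (e.occ_lt k j)
theorem DerI.occ_lt : ∀ {n : ℕ} {Γ : Fin n → List ITy} {M : Lam n} {As : List ITy}
    (e : DerI enum Γ M As) (k : Fin n), ∀ j ∈ e.occ k, j < (Γ k).length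
  | _, _, _, _, .nil, k => by simp [DerI.occ]
  | _, _, _, _, .cons d e, k => by
      intro j hj
      rw [DerI.occ, List.mem_append] at hj
      exact hj.elim (d.occ_lt k j) (e.occ_lt k j)
end

theorem Der.cart_isGround {Γ : Fin n → List ITy} {M : Lam n} {A : ITy} (d : Der enum Γ M A) :
    d.cart.IsGround (fun i => trList (Γ i)) d.ctx :=
  fun i => ⟨d.occ i, by simpa [trList_eq_map] using d.occ_lt i, rfl, rfl⟩

mutual
theorem Der.hasType : ∀ {n : ℕ} {Γ : Fin n → List ITy} {M : Lam n} {A : ITy}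
    (d : Der enum Γ M A), HasType d.ctx d.coarse (trTy A)
  | _, _, _, _, .var i j h => by
      rw [Der.ctx_var]
      exact .var i _
  | _, Γ, _, _, .lam (As := As) hAs d => by
      have ih := d.hasType
      rw [Der.ctx_lam] at ih
      rw [Der.coarse, trTy]
      refine .lam ih (ground_hasTy _ _ ?_)
      simpa [trList_eq_map] using d.occ_lt 0
  | _, _, _, _, .app d e => by
      have ih := d.hasType
      rw [trTy] at ih
      rw [Der.ctx_app]
      exact .app ih e.hasType
theorem DerI.hasType : ∀ {n : ℕ} {Γ : Fin n → List ITy} {M : Lam n} {As : List ITy}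
    (e : DerI enum Γ M As), HasBagType e.ctx e.coarse (trList As)
  | _, _, _, _, .nil => .nil
  | _, _, _, _, .cons d e => by
      rw [DerI.ctx_cons]
      exact .cons d.hasType e.hasType
end

mutual
theorem Der.approx : ∀ {n : ℕ} {Γ : Fin n → List ITy} {M : Lam n} {A : ITy}
    (d : Der enum Γ M A), Approx d.coarse M
  | _, _, _, _, .var i _ _ => .var i
  | _, _, _, _, .lam _ d => .lam d.approx
  | _, _, _, _, .app d e => .app d.approx e.approx
theorem DerI.approx : ∀ {n : ℕ} {Γ : Fin n → List ITy} {M : Lam n} {As : List ITy}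
    (e : DerI enum Γ M As), ApproxBag e.coarse M
  | _, _, _, _, .nil => .nil
  | _, _, _, _, .cons d e => .cons d.approx e.approx
end

/-- An application node of `Der` does not itself require a nonempty intersection for its argument.
That is recovered from the type of the function, once it is known to be idempotent. -/
theorem Der.isIdem : ∀ {n : ℕ} {Γ : Fin n → List ITy} {M : Lam n} {A : ITy}
    (_ : Der enum Γ M A), (∀ i, IsInter enum (Γ i)) → IsIdem enum A
  | _, _, _, _, .var i j h, hΓ => (hΓ i).2.1 _ (List.mem_of_getElem? h)
  | _, _, _, _, .lam hAs d, hΓ =>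
      .arr hAs.1 hAs.2.1 hAs.2.2 (d.isIdem fun i => Fin.cases hAs hΓ i)
  | _, _, _, _, .app d e, hΓ => by
      cases d.isIdem hΓ
      assumption

/-! ### Renaming of derivations -/

theorem liftRen_injective {m n : ℕ} {ρ : Fin n → Fin m} (h : Function.Injective ρ) :
    Function.Injective (liftRen ρ) := by
  intro i j
  refine Fin.cases ?_ (fun i => ?_) i <;> refine Fin.cases ?_ (fun j => ?_) j
  · simp
  · intro e; exact absurd e (Fin.succ_ne_zero _).symm
  · intro e; exact absurd e (Fin.succ_ne_zero _)
  · intro e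
    exact congrArg Fin.succ (h (Fin.succ_injective _ e))

mutual
-- The same positions are reused, which is why the contexts must agree exactly along `ρ`.
-- Injectivity prevents the occurrences of two variables from being merged.
theorem Der.exists_rename : ∀ {n : ℕ} {Γ : Fin n → List ITy} {M : Lam n} {A : ITy}
    (d : Der enum Γ M A) {m : ℕ} (Δ : Fin m → List ITy) (ρ : Fin n → Fin m),
    Function.Injective ρ → (∀ i, Δ (ρ i) = Γ i) →
    ∃ d' : Der enum Δ (M.rename ρ) A, d'.coarse = d.coarse.rename ρ ∧
      (∀ i, d'.occ (ρ i) = d.occ i) ∧ ∀ j, (∀ i, ρ i ≠ j) → d'.occ j = []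
  | _, Γ, _, _, .var i j h, m, Δ, ρ, hρ, hΔ => by
      refine ⟨.var (ρ i) j (by rw [hΔ, h]), by simp [Der.coarse, Tm.rename], ?_, ?_⟩
      · intro k
        simp [Der.occ, hρ.eq_iff]
      · intro k hk
        have := hk i
        simp [Der.occ, this.symm]
  | n, Γ, _, _, .lam (As := As) hAs d, m, Δ, ρ, hρ, hΔ => by
      obtain ⟨d', h₁, h₂, h₃⟩ := d.exists_rename (ext As Δ) (liftRen ρ) (liftRen_injective hρ)
        (fun i => Fin.cases rfl hΔ i)
      refine ⟨.lam hAs d', ?_, fun i => h₂ i.succ, fun j hj => h₃ j.succ fun i => ?_⟩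
      · change Tm.lam (ground (trList As) (d'.occ 0)) d'.coarse = _
        rw [Der.coarse, Tm.rename, h₁, ← h₂ 0]
        rfl
      · refine Fin.cases ?_ (fun i => ?_) i
        · exact (Fin.succ_ne_zero j).symm
        · intro e
          exact hj i (Fin.succ_injective _ e)
  | n, Γ, _, _, .app d e, m, Δ, ρ, hρ, hΔ => by
      obtain ⟨d', h₁, h₂, h₃⟩ := d.exists_rename Δ ρ hρ hΔ
      obtain ⟨e', k₁, k₂, k₃⟩ := e.exists_rename Δ ρ hρ hΔ
      refine ⟨.app d' e', ?_, ?_, ?_⟩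
      · simp [Der.coarse, Tm.rename, h₁, k₁]
      · intro i
        simp [Der.occ, h₂, k₂]
      · intro j hj
        simp [Der.occ, h₃ j hj, k₃ j hj]
theorem DerI.exists_rename : ∀ {n : ℕ} {Γ : Fin n → List ITy} {M : Lam n} {As : List ITy}
    (e : DerI enum Γ M As) {m : ℕ} (Δ : Fin m → List ITy) (ρ : Fin n → Fin m),
    Function.Injective ρ → (∀ i, Δ (ρ i) = Γ i) →
    ∃ e' : DerI enum Δ (M.rename ρ) As, e'.coarse = e.coarse.rename ρ ∧
      (∀ i, e'.occ (ρ i) = e.occ i) ∧ ∀ j, (∀ i, ρ i ≠ j) → e'.occ j = []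
  | _, Γ, _, _, .nil, m, Δ, ρ, hρ, hΔ =>
      ⟨.nil, by simp [DerI.coarse, Bag.rename], fun _ => rfl, fun _ _ => rfl⟩
  | _, Γ, _, _, .cons d e, m, Δ, ρ, hρ, hΔ => by
      obtain ⟨d', h₁, h₂, h₃⟩ := d.exists_rename Δ ρ hρ hΔ
      obtain ⟨e', k₁, k₂, k₃⟩ := e.exists_rename Δ ρ hρ hΔ
      refine ⟨.cons d' e', ?_, ?_, ?_⟩
      · simp [DerI.coarse, Bag.rename, h₁, k₁]
      · intro i
        simp [DerI.occ, h₂, k₂]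
      · intro j hj
        simp [DerI.occ, h₃ j hj, k₃ j hj]
end

/-! ### Bags selected from the derivations for an argument -/

/-- The bag of the terms `T j`, for the `j` in a list. -/
def bagOf (T : ℕ → Tm n) : List ℕ → Bag n
  | [] => Bag.nil
  | j :: l => Bag.cons (T j) (bagOf T l)

theorem bagOf_append (T : ℕ → Tm n) : ∀ l l' : List ℕ,
    bagOf T (l ++ l') = (bagOf T l).append (bagOf T l')
  | [], _ => rfl
  | _ :: l, l' => by simp [bagOf, Bag.append, bagOf_append T l l']

theorem bagOf_rename (T : ℕ → Tm n) {m : ℕ} (ρ : Fin n → Fin m) : ∀ l : List ℕ,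
    (bagOf T l).rename ρ = bagOf (fun j => (T j).rename ρ) l
  | [] => by simp [bagOf, Bag.rename]
  | _ :: l => by simp [bagOf, Bag.rename, bagOf_rename T ρ l]

/-- The occurrences `O j`, for the `j` in a list. -/
def occOf (O : ℕ → Fin n → List ℕ) (l : List ℕ) : Fin n → List ℕ := fun i => l.flatMap (O · i)

theorem occOf_cons (O : ℕ → Fin n → List ℕ) (j : ℕ) (l : List ℕ) :
    occOf O (j :: l) = fun i => O j i ++ occOf O l i := by
  funext i; simp [occOf]

theorem occOf_append (O : ℕ → Fin n → List ℕ) (l l' : List ℕ) :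
    occOf O (l ++ l') = fun i => occOf O l i ++ occOf O l' i := by
  funext i; simp [occOf]

theorem occOf_ext (O : ℕ → Fin n → List ℕ) : ∀ l : List ℕ,
    occOf (fun j => ext [] (O j)) l = ext [] (occOf O l) := by
  intro l; funext i
  refine Fin.cases ?_ (fun i => rfl) i
  simp [occOf]

/-- `T j` and `O j` are the coarse approximation and the occurrences of a derivation of the `j`-th
type of `As`. -/
def Family (enum : ITy → ℕ) (Γ : Fin n → List ITy) (N : Lam n) (As : List ITy) (T : ℕ → Tm n)
    (O : ℕ → Fin n → List ℕ) : Prop :=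
  ∀ j A, As[j]? = some A → ∃ d : Der enum Γ N A, d.coarse = T j ∧ d.occ = O j

/-- Used to carry the argument under a binder: the weakened derivations do not use the new variable,
hence the `[]`. -/
theorem Family.rename {Γ : Fin n → List ITy} {N : Lam n} {As : List ITy} {T : ℕ → Tm n}
    {O : ℕ → Fin n → List ℕ} (h : Family enum Γ N As T O) (Bs : List ITy) :
    Family enum (ext Bs Γ) (N.rename Fin.succ) As (fun j => (T j).rename Fin.succ)
      (fun j => ext [] (O j)) := by
  intro j A hj
  obtain ⟨d, h₁, h₂⟩ := h j A hj
  obtain ⟨d', k₁, k₂, k₃⟩ := d.exists_rename (ext Bs Γ) Fin.succ (Fin.succ_injective _)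
    (fun _ => rfl)
  refine ⟨d', by rw [k₁, h₁], funext fun i => ?_⟩
  refine Fin.cases ?_ (fun i => ?_) i
  · exact k₃ 0 fun i => Fin.succ_ne_zero i
  · rw [k₂, h₂]; rfl

theorem Family.hasBagType {Γ : Fin n → List ITy} {N : Lam n} {As : List ITy} {T : ℕ → Tm n}
    {O : ℕ → Fin n → List ℕ} (h : Family enum Γ N As T O) : ∀ l : List ℕ, (∀ j ∈ l, j < As.length) →
    HasBagType (occCtx Γ (occOf O l)) (bagOf T l) (reindex (trList As) l)
  | [], _ => .nil
  | j :: l, hl => by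
      have hj := hl j (by simp)
      obtain ⟨d, h₁, h₂⟩ := h j As[j] (by simp [hj])
      have := HasBagType.cons d.hasType (h.hasBagType l fun i hi => hl i (by simp [hi]))
      rw [h₁, d.ctx_eq, h₂, ← occCtx_append] at this
      rw [occOf_cons]
      simpa [bagOf, reindex, trList_eq_map, hj] using this

/-- Turns the derivations of an argument into families indexed by position, so that elements can be
selected with repetition. -/
theorem DerI.exists_family : ∀ {As : List ITy} {Γ : Fin n → List ITy} {N : Lam n}
    (e : DerI enum Γ N As), ∃ (T : ℕ → Tm n) (O : ℕ → Fin n → List ℕ), Family enum Γ N As T O ∧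
      ∀ j < As.length, ∃ ρ, CMor.Occ Γ e.occ (O j) ρ ∧
        BagGet e.ctx e.coarse j (occCtx Γ (O j)) ρ (T j)
  -- No index is in range, so any term will do; a closed one exists even for `n = 0`.
  | [], Γ, N, e => ⟨fun _ => Tm.app (Tm.lam (LMor.nil []) (Tm.var 0)) Bag.nil, fun _ _ => [],
      fun j A h => by simp at h, by simp⟩
  | A :: As, Γ, N, .cons d e => by
      obtain ⟨T, O, h₁, h₂⟩ := e.exists_family
      refine ⟨fun j => Nat.casesOn j d.coarse T, fun j => Nat.casesOn j d.occ O, ?_, ?_⟩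
      · intro j B hj
        cases j with
        | zero =>
          obtain rfl : A = B := by simpa using hj
          exact ⟨d, rfl, rfl⟩
        | succ j => exact h₁ j B (by simpa using hj)
      · intro j hj
        rw [DerI.ctx_cons]
        cases j with
        | zero => exact ⟨_, CMor.Occ.projL Γ d.occ e.occ, .zero d.hasType e.hasType⟩
        | succ j =>
          obtain ⟨ρ, k₁, k₂⟩ := h₂ j (by simpa using hj)
          exact ⟨_, k₁.comp (CMor.Occ.projR Γ d.occ e.occ), .succ d.hasType k₂⟩

/-- A ground morphism acts on a bag by pure selection, its components being identities. Repeated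
indices duplicate elements, missing ones erase them, and the free variable occurrences follow. -/
theorem Family.covBag {Γ : Fin n → List ITy} {N : Lam n} {As : List ITy} {T : ℕ → Tm n}
    {O : ℕ → Fin n → List ℕ} (h : Family enum Γ N As T O) {o : Fin n → List ℕ} {q : Bag n}
    (hq : HasBagType (occCtx Γ o) q (trList As))
    (hg : ∀ j < As.length, ∃ ρ, CMor.Occ Γ o (O j) ρ ∧
        BagGet (occCtx Γ o) q j (occCtx Γ (O j)) ρ (T j)) :
    ∀ l : List ℕ, (∀ j ∈ l, j < As.length) → ∃ μ, CMor.Occ Γ o (occOf O l) μ ∧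
      CovBag (occCtx Γ o) q (ground (trList As) l) (occCtx Γ (occOf O l)) μ (bagOf T l)
  | [], _ => ⟨_, CMor.Occ.termC Γ o, .nil hq⟩
  | j :: l, hl => by
      have hj := hl j (by simp)
      obtain ⟨μ, k₁, k₂⟩ := h.covBag hq hg l fun i hi => hl i (by simp [hi])
      obtain ⟨ρ, g₁, g₂⟩ := hg j hj
      obtain ⟨d, h₁, h₂⟩ := h j As[j] (by simp [hj])
      have hd := d.hasType.cov_id
      rw [h₁, d.ctx_eq, h₂] at hd
      have := CovBag.cons g₂ hd k₂
      refine ⟨_, ((CMor.Occ.id Γ (O j)).comp g₁).pair k₁, ?_⟩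
      rw [← occCtx_append] at this
      rw [occOf_cons]
      simpa [ground, bagOf, trList_eq_map, hj] using this

/-! ### Linear substitution in coarse approximations -/

theorem subst_lift_succAbove {k : Fin (n + 1)} {τ : Fin (n + 1) → Lam n}
    (hτ : ∀ i, τ (k.succAbove i) = Lam.var i) (i : Fin (n + 1)) :
    ext (Lam.var 0) (fun i => (τ i).rename Fin.succ) (k.succ.succAbove i) = Lam.var i := by
  refine Fin.cases ?_ (fun i => ?_) i
  · rw [Fin.succ_succAbove_zero]; rfl
  · rw [Fin.succ_succAbove_succ, ext_succ, hτ]; rfl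

theorem ext_succAbove {α : Type} {k : Fin (n + 1)} {γ : Fin n → α} {δ : Fin (n + 1) → α}
    (h : ∀ i, γ i = δ (k.succAbove i)) (a : α) (i : Fin (n + 1)) :
    ext a γ i = ext a δ (k.succ.succAbove i) := by
  refine Fin.cases ?_ (fun i => ?_) i
  · rw [Fin.succ_succAbove_zero]; rfl
  · rw [Fin.succ_succAbove_succ, ext_succ, ext_succ, h]

/-- The occurrences in the result of a linear substitution, before the permutation. -/
def plugOcc (k : Fin (n + 1)) (o : Fin (n + 1) → List ℕ) (O : ℕ → Fin n → List ℕ) :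
    Fin n → List ℕ := fun i => o (k.succAbove i) ++ occOf O (o k) i

/-- The bag is divided between two subterms. Before the swap all remaining occurrences of the term
precede those of the bag; after it each subterm is next to its own share. -/
theorem occ_comp_swap {Γ : Fin n → List ITy} {Γ' : Fin (n + 1) → List ITy} {k : Fin (n + 1)}
    (hΓ : ∀ i, Γ i = Γ' (k.succAbove i))
    {o₀ o₁ : Fin (n + 1) → List ℕ} {O : ℕ → Fin n → List ℕ} {p₀ p₁ : Fin n → List ℕ}
    {σ₀ σ₁ : CMor n} (h₀ : CMor.Occ Γ (plugOcc k o₀ O) p₀ σ₀)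
    (h₁ : CMor.Occ Γ (plugOcc k o₁ O) p₁ σ₁) :
    CMor.Occ Γ (plugOcc k (fun i => o₀ i ++ o₁ i) O) (fun i => p₀ i ++ p₁ i)
      ((σ₀.tensor σ₁).comp (swapC (fun i => occCtx Γ' o₀ (k.succAbove i))
        (fun i => occCtx Γ' o₁ (k.succAbove i)) (occCtx Γ (occOf O (o₀ k)))
        (occCtx Γ (occOf O (o₁ k))))) := by
  have hs := CMor.Occ.swap Γ (fun i => o₀ (k.succAbove i)) (fun i => o₁ (k.succAbove i))
    (occOf O (o₀ k)) (occOf O (o₁ k))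
  have e : ∀ o : Fin (n + 1) → List ℕ,
      occCtx Γ (fun i => o (k.succAbove i)) = fun i => occCtx Γ' o (k.succAbove i) := by
    intro o; funext i; simp [occCtx, hΓ]
  rw [e, e] at hs
  have := (h₀.tensor h₁).comp hs
  rwa [show plugOcc k (fun i => o₀ i ++ o₁ i) O = fun i => o₀ (k.succAbove i) ++
    o₁ (k.succAbove i) ++ (occOf O (o₀ k) i ++ occOf O (o₁ k) i) by
    funext i; rw [plugOcc, occOf_append]]

mutual
-- An occurrence of the variable `k` that uses position `j` is replaced by the `j`-th derivation of
-- the argument. The bag lists these derivations in the order of the occurrences, so linear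
-- substitution makes the same replacements and gives exactly `d'.coarse`. Allowing any `k`, and any
-- `τ` that fixes the other variables, makes the induction pass under binders.
theorem Der.exists_subst {n : ℕ} {Γ' : Fin (n + 1) → List ITy} {M : Lam (n + 1)} {B : ITy}
    (d : Der enum Γ' M B) (k : Fin (n + 1)) (Γ : Fin n → List ITy)
    (hΓ : ∀ i, Γ i = Γ' (k.succAbove i)) (τ : Fin (n + 1) → Lam n)
    (hτ : ∀ i, τ (k.succAbove i) = Lam.var i) (T : ℕ → Tm n) (O : ℕ → Fin n → List ℕ)
    (hF : Family enum Γ (τ k) (Γ' k) T O) :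
    ∃ (d' : Der enum Γ (M.subst τ) B) (σ : CMor n), CMor.Occ Γ (plugOcc k d.occ O) d'.occ σ ∧
      LSub k d.ctx d.coarse (occCtx Γ (occOf O (d.occ k))) (bagOf T (d.occ k)) d'.ctx σ
        d'.coarse :=
  match d with
  | .var i j h => by
      rcases Fin.eq_self_or_eq_succAbove k i with rfl | ⟨i, rfl⟩
      · obtain ⟨d', h₁, h₂⟩ := hF j _ h
        refine ⟨d', idC d'.ctx, ?_, ?_⟩
        · have e : plugOcc i (Der.var (enum := enum) i j h).occ O = d'.occ := by
            funext l
            simp [plugOcc, occOf, Der.occ, h₂]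
          rw [e]
          exact CMor.Occ.id Γ d'.occ
        · have e₁ : occCtx Γ (occOf O [j]) = d'.ctx := by
            rw [Der.ctx_eq, h₂]
            funext l
            simp [occCtx, occOf]
          have e₂ : (Der.var (enum := enum) i j h).occ i = [j] := by simp [Der.occ]
          rw [Der.ctx_var, e₂, e₁, bagOf, bagOf, ← h₁]
          exact .var_eq d'.hasType
      · rw [Lam.subst, hτ]
        have h' : (Γ i)[j]? = some B := by rw [hΓ, h]
        refine ⟨.var i j h', idC (Der.var (enum := enum) i j h').ctx, ?_, ?_⟩
        · have e : plugOcc k (Der.var (enum := enum) (k.succAbove i) j h).occ O =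
              (Der.var (enum := enum) i j h').occ := by
            funext l
            simp [plugOcc, occOf, Der.occ, Fin.ne_succAbove]
          rw [e]
          exact CMor.Occ.id Γ _
        · have e : (Der.var (enum := enum) (k.succAbove i) j h).occ k = [] := by
            simp [Der.occ, Fin.ne_succAbove]
          rw [Der.ctx_var, Der.ctx_var, e]
          exact .var_ne
  | .lam (As := As) hAs d => by
      have hF' := hF.rename As
      obtain ⟨d', σ, h₁, h₂⟩ := d.exists_subst k.succ (ext As Γ) (ext_succAbove hΓ As)
        (ext (Lam.var 0) (fun i => (τ i).rename Fin.succ)) (subst_lift_succAbove hτ) _ _ hF'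
      refine ⟨.lam hAs d', fun i => σ i.succ, ?_, ?_⟩
      · intro i
        have := h₁ i.succ
        simp only [plugOcc, Fin.succ_succAbove_succ, occOf_ext, ext_succ] at this
        exact this
      · rw [← bagOf_rename, occOf_ext, occCtx_ext, ← ext_eta σ, d.ctx_lam, d'.ctx_lam] at h₂
        have := LSub.lam (ground_hasTy (trList As) (d.occ 0)
          (by simpa [trList_eq_map] using d.occ_lt 0)) h₂
        -- The renamed bag contains no occurrence of the bound variable, so `σ 0` relates its
        -- occurrences before and after the substitution and carries the canonical annotation to the
        -- canonical one.
        have e := h₁ 0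
        simp only [plugOcc, Fin.succ_succAbove_zero, occOf_ext, ext_zero, List.append_nil] at e
        rw [e.comp_ground] at this
        exact this
  | .app d e => by
      obtain ⟨d', σ₀, h₁, h₂⟩ := d.exists_subst k Γ hΓ τ hτ T O hF
      obtain ⟨e', σ₁, k₁, k₂⟩ := e.exists_subst k Γ hΓ τ hτ T O hF
      refine ⟨.app d' e', _, occ_comp_swap hΓ h₁ k₁, ?_⟩
      have := LSub.app h₂ k₂
      rw [Der.ctx_app, show (Der.app d e).occ k = d.occ k ++ e.occ k by rw [Der.occ],
        occOf_append, occCtx_append, bagOf_append]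
      have e₁ := Der.ctx_app d' e'
      rw [← e₁] at this
      exact this
theorem DerI.exists_subst {n : ℕ} {Γ' : Fin (n + 1) → List ITy} {M : Lam (n + 1)} {Bs : List ITy}
    (d : DerI enum Γ' M Bs) (k : Fin (n + 1)) (Γ : Fin n → List ITy)
    (hΓ : ∀ i, Γ i = Γ' (k.succAbove i)) (τ : Fin (n + 1) → Lam n)
    (hτ : ∀ i, τ (k.succAbove i) = Lam.var i) (T : ℕ → Tm n) (O : ℕ → Fin n → List ℕ)
    (hF : Family enum Γ (τ k) (Γ' k) T O) :
    ∃ (d' : DerI enum Γ (M.subst τ) Bs) (σ : CMor n), CMor.Occ Γ (plugOcc k d.occ O) d'.occ σ ∧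
      LSubBag k d.ctx d.coarse (occCtx Γ (occOf O (d.occ k))) (bagOf T (d.occ k)) d'.ctx σ
        d'.coarse :=
  match d with
  | .nil => ⟨.nil, _, CMor.Occ.id Γ (fun _ => []), .nil⟩
  | .cons d e => by
      obtain ⟨d', σ₀, h₁, h₂⟩ := d.exists_subst k Γ hΓ τ hτ T O hF
      obtain ⟨e', σ₁, k₁, k₂⟩ := e.exists_subst k Γ hΓ τ hτ T O hF
      refine ⟨.cons d' e', _, occ_comp_swap hΓ h₁ k₁, ?_⟩
      have := LSubBag.cons h₂ k₂
      rw [DerI.ctx_cons, show (DerI.cons d e).occ k = d.occ k ++ e.occ k by rw [DerI.occ],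
        occOf_append, occCtx_append, bagOf_append]
      have e₁ := DerI.ctx_cons d' e'
      rw [← e₁] at this
      exact this
end

/-! ### Simulation of β-reduction -/

/-- The coarse approximation `d` reduces to `d'`, by at most one exponential step and one linear
step with ground labels. -/
def Simulates {Γ : Fin n → List ITy} {M N : Lam n} {A : ITy} (d : Der enum Γ M A)
    (d' : Der enum Γ N A) : Prop :=
  ∃ (o : Fin n → List ℕ) (t : Tm n) (ν ν' : CMor n), HasType (occCtx Γ o) t (trTy A) ∧
    CMor.Occ Γ d.occ o ν ∧ CMor.Occ Γ o d'.occ ν' ∧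
    ExpStepOpt n d.ctx d.coarse (trTy A) ν (idM (trTy A)) (occCtx Γ o) t (trTy A) ∧
    LinStep n (occCtx Γ o) t (trTy A) ν' (idM (trTy A)) d'.ctx d'.coarse (trTy A)

-- Closure of the simulation under abstraction, application and bags.

theorem BagStep.ne_nil {R : LRel} {γ γ' : Ctx n} {q q' : Bag n} {as as' : List RTy} {θ : CMor n}
    {f : LMor} (h : BagStep R n γ q as θ f γ' q' as') : as ≠ [] := by
  cases h <;> simp

/-- The analogue of `ExpStepOpt` for bags. -/
def ExpBagStepOpt (n : ℕ) (γ : Ctx n) (q : Bag n) (as : List RTy) (θ : CMor n) (γ' : Ctx n)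
    (q' : Bag n) : Prop :=
  (γ' = γ ∧ q' = q ∧ θ = idC γ) ∨ BagStep ExpRoot n γ q as θ (idL as) γ' q' as

theorem ExpStepOpt.lam {γ γ' : Ctx n} {as as' bs : List RTy} {s s' : Tm (n + 1)} {a a' : RTy}
    {θ : CMor (n + 1)} {f : Mor} {g : LMor} (hg : LMor.HasTy g bs as)
    (h : ExpStepOpt (n + 1) (ext as γ) s a θ f (ext as' γ') s' a') :
    ExpStepOpt n γ (Tm.lam g s) (RTy.arr bs a) (fun i => θ i.succ) (Mor.arr (idL bs) f) γ'
      (Tm.lam ((θ 0).comp g) s') (RTy.arr bs a') := by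
  generalize hx : ext as γ = x at h
  generalize hy : ext as' γ' = y at h
  cases h with
  | refl =>
    subst hx
    obtain rfl : as' = as := by simpa using congrFun hy 0
    obtain rfl : γ' = γ := by
      funext i
      simpa using congrFun hy i.succ
    rw [← idM_arr]
    have e : (idC (ext as' γ') 0).comp g = g := hg.id_comp
    rw [e]
    exact .refl
  | step h =>
    subst hx hy
    rw [← ext_eta θ] at h
    exact .step (.lam h hg)

theorem ExpStepOpt.appL {γ γ' δ : Ctx n} {s s' : Tm n} {t : Bag n} {as : List RTy} {b : RTy}
    {θ : CMor n} (ht : HasBagType δ t as)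
    (h : ExpStepOpt n γ s (RTy.arr as b) θ (idM (RTy.arr as b)) γ' s' (RTy.arr as b)) :
    ExpStepOpt n (γ.tensor δ) (Tm.app s t) b (θ.tensor (idC δ)) (idM b) (γ'.tensor δ)
      (Tm.app s' t) b := by
  generalize hf : idM (RTy.arr as b) = f at h
  cases h with
  | refl =>
    rw [idC_tensor]
    exact .refl
  | step h =>
    rw [← hf, idM_arr] at h
    exact .step (.appL h ht ht.cov_id)

theorem ExpStepOpt.appR {γ δ δ' : Ctx n} {s : Tm n} {t t' : Bag n} {as : List RTy} {b : RTy}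
    {θ : CMor n} (hs : HasType γ s (RTy.arr as b)) (h : ExpBagStepOpt n δ t as θ δ' t') :
    ExpStepOpt n (γ.tensor δ) (Tm.app s t) b ((idC γ).tensor θ) (idM b) (γ.tensor δ')
      (Tm.app s t') b := by
  rcases h with ⟨rfl, rfl, rfl⟩ | h
  · rw [idC_tensor]
    exact .refl
  · have hc := hs.cov_id
    rw [idM_arr] at hc
    exact .step (.appR h hs hc)

/-- A step in a bag reduces any nonempty set of positions, so elements that need no exponential step
simply stay put. No step at all is made only if none of them needs one. -/
theorem ExpBagStepOpt.cons {γ γ' δ δ' : Ctx n} {s s' : Tm n} {t t' : Bag n} {as : List RTy}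
    {a : RTy} {θ η : CMor n} (hs : HasType γ s a) (ht : HasBagType δ t as)
    (h : ExpStepOpt n γ s a θ (idM a) γ' s' a) (h' : ExpBagStepOpt n δ t as η δ' t') :
    ExpBagStepOpt n (γ.tensor δ) (Bag.cons s t) (a :: as) (θ.tensor η) (γ'.tensor δ')
      (Bag.cons s' t') := by
  generalize hf : idM a = f at h
  rw [ExpBagStepOpt, ← consL_id]
  cases h with
  | refl =>
    rcases h' with ⟨rfl, rfl, rfl⟩ | h'
    · exact .inl ⟨rfl, rfl, idC_tensor _ _⟩
    · exact .inr (.tail hs h')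
  | step h =>
    rw [← hf] at h
    rcases h' with ⟨rfl, rfl, rfl⟩ | h'
    · exact .inr (.head h ht)
    · exact .inr (.both h h')

theorem Simulates.lam {Γ : Fin n → List ITy} {As : List ITy} {M N : Lam (n + 1)} {B : ITy}
    (hAs : IsInter enum As) {d : Der enum (ext As Γ) M B} {d' : Der enum (ext As Γ) N B}
    (h : Simulates d d') : Simulates (Der.lam hAs d) (Der.lam hAs d') := by
  obtain ⟨o, t, ν, ν', ht, h₁, h₂, h₃, h₄⟩ := h
  have hg : LMor.HasTy (ground (trList As) (d.occ 0)) (trList As)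
      (reindex (trList As) (d.occ 0)) :=
    ground_hasTy _ _ (by simpa [trList_eq_map] using d.occ_lt 0)
  have ho : occCtx (ext As Γ) o = ext (reindex (trList As) (o 0))
      (occCtx Γ fun i => o i.succ) := by
    rw [← occCtx_ext, ext_eta]
  -- Reducing the body composes its label at the bound variable with the annotation; the annotation
  -- stays canonical for the new list of occurrences.
  have e₁ : (ν 0).comp (ground (trList As) (d.occ 0)) = ground (trList As) (o 0) :=
    (h₁ 0).comp_ground
  have e₂ : (ν' 0).comp (ground (trList As) (o 0)) = ground (trList As) (d'.occ 0) :=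
    (h₂ 0).comp_ground
  have hg' : LMor.HasTy (ground (trList As) (o 0)) (trList As) (reindex (trList As) (o 0)) := by
    rw [← e₁]
    exact ((h₁ 0).isGround.comp ⟨d.occ 0, by simpa [trList_eq_map] using d.occ_lt 0,
      rfl, rfl⟩).hasTy
  rw [ho] at ht h₃ h₄
  rw [d.ctx_lam] at h₃
  rw [d'.ctx_lam, ← ext_eta ν'] at h₄
  refine ⟨fun i => o i.succ, Tm.lam (ground (trList As) (o 0)) t, fun i => ν i.succ,
    fun i => ν' i.succ, ?_, fun i => h₁ i.succ, fun i => h₂ i.succ, ?_, ?_⟩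
  · rw [trTy]
    exact .lam ht hg'
  · have := h₃.lam hg
    rw [e₁, ← idM_arr] at this
    rw [trTy]
    exact this
  · have := Step.lam h₄ hg'
    rw [e₂, ← idM_arr] at this
    rw [trTy]
    exact this

theorem Simulates.appL {Γ : Fin n → List ITy} {As : List ITy} {M M' N : Lam n} {B : ITy}
    {d : Der enum Γ M (ITy.arr As B)} {d' : Der enum Γ M' (ITy.arr As B)} (e : DerI enum Γ N As)
    (h : Simulates d d') : Simulates (Der.app d e) (Der.app d' e) := by
  obtain ⟨o, t, ν, ν', ht, h₁, h₂, h₃, h₄⟩ := h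
  rw [trTy] at ht h₃ h₄
  refine ⟨fun i => o i ++ e.occ i, Tm.app t e.coarse, _, _, ?_,
    h₁.tensor (CMor.Occ.id Γ e.occ), h₂.tensor (CMor.Occ.id Γ e.occ), ?_, ?_⟩
  · rw [occCtx_append]
    exact .app ht e.hasType
  · rw [Der.ctx_app, occCtx_append]
    exact h₃.appL e.hasType
  · rw [Der.ctx_app, occCtx_append]
    rw [idM_arr] at h₄
    exact .appL h₄ e.hasType e.hasType.cov_id

/-- The exponential steps that are needed are made together, and then every element makes its linear
step at once. An empty bag has no step, hence the condition on the linear part; the last clause only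
serves to extend an empty bag by one element. -/
theorem DerI.exists_simulation {Γ : Fin n → List ITy} {N N' : Lam n}
    (H : ∀ A (d : Der enum Γ N A), ∃ d' : Der enum Γ N' A, Simulates d d') :
    ∀ {As : List ITy} (e : DerI enum Γ N As), ∃ (e' : DerI enum Γ N' As) (o : Fin n → List ℕ)
      (q : Bag n) (ν ν' : CMor n), HasBagType (occCtx Γ o) q (trList As) ∧
      CMor.Occ Γ e.occ o ν ∧ CMor.Occ Γ o e'.occ ν' ∧
      ExpBagStepOpt n e.ctx e.coarse (trList As) ν (occCtx Γ o) q ∧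
      (As ≠ [] → BagStep LinRoot n (occCtx Γ o) q (trList As) ν' (idL (trList As)) e'.ctx e'.coarse
        (trList As)) ∧
      (As = [] → ν' = idC Ctx.empty)
  | [], .nil => ⟨.nil, fun _ => [], Bag.nil, idC Ctx.empty, idC Ctx.empty, .nil,
      CMor.Occ.id Γ fun _ => [], CMor.Occ.id Γ fun _ => [], .inl ⟨rfl, rfl, rfl⟩, by simp, by simp⟩
  | A :: As, .cons d e => by
      obtain ⟨d', o, t, ν, ν', ht, h₁, h₂, h₃, h₄⟩ := H A d
      obtain ⟨e', p, q, η, η', kt, k₁, k₂, k₃, k₄, k₅⟩ := e.exists_simulation H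
      refine ⟨.cons d' e', fun i => o i ++ p i, Bag.cons t q, _, _, ?_, h₁.tensor k₁,
        h₂.tensor k₂, ?_, fun _ => ?_, by simp⟩
      · rw [occCtx_append]
        exact .cons ht kt
      · rw [occCtx_append, DerI.ctx_cons]
        exact ExpBagStepOpt.cons d.hasType e.hasType h₃ k₃
      · rw [occCtx_append, DerI.ctx_cons, trList, ← consL_id]
        cases As with
        | nil =>
          cases e' with
          | nil =>
            cases e with
            | nil =>
              -- In a one-element bag only the head can step, since `both` would require a step in
              -- the empty tail.
              have hq : BagStep LinRoot n ((occCtx Γ o).tensor (occCtx Γ p)) (Bag.cons t q)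
                [trTy A] (ν'.tensor (idC (occCtx Γ p))) (consL (trTy A) (idM (trTy A)) (idL []))
                (d'.ctx.tensor (occCtx Γ p)) (Bag.cons d'.coarse q) [trTy A] := .head h₄ kt
              rcases k₃ with ⟨hp, hq', -⟩ | hb
              · rw [k₅ rfl]
                rw [hp, hq'] at hq ⊢
                exact hq
              · exact absurd rfl hb.ne_nil
        | cons A' As => exact .both h₄ (k₄ (by simp))

/-- The steps preserve the type of the bag, so the induced action on the function part is by an
identity and changes nothing. -/
theorem Simulates.appR {Γ : Fin n → List ITy} {As : List ITy} {M N N' : Lam n} {B : ITy}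
    (d : Der enum Γ M (ITy.arr As B)) (e : DerI enum Γ N As) (hAs : As ≠ [])
    (H : ∀ A (d : Der enum Γ N A), ∃ d' : Der enum Γ N' A, Simulates d d') :
    ∃ d' : Der enum Γ (Lam.app M N') B, Simulates (Der.app d e) d' := by
  obtain ⟨e', o, q, ν, ν', ht, h₁, h₂, h₃, h₄, -⟩ := e.exists_simulation H
  have hd := d.hasType
  rw [trTy] at hd
  refine ⟨.app d e', fun i => d.occ i ++ o i, Tm.app d.coarse q, _, _, ?_,
    (CMor.Occ.id Γ d.occ).tensor h₁, (CMor.Occ.id Γ d.occ).tensor h₂, ?_, ?_⟩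
  · rw [occCtx_append]
    exact .app hd ht
  · rw [occCtx_append, Der.ctx_app]
    exact ExpStepOpt.appR hd h₃
  · rw [occCtx_append, Der.ctx_app]
    have hc := hd.cov_id
    rw [idM_arr] at hc
    exact .appR (h₄ hAs) hd hc

-- Contraction of a β-redex and the simulation theorem.

theorem IsPerm.id (as : List RTy) : IsPerm (idL as) as as :=
  ⟨List.range as.length, List.Perm.refl _, idL_eq_ground as, (reindex_range as).symm⟩

theorem Simulates.beta {Γ : Fin n → List ITy} {As : List ITy} {M : Lam (n + 1)} {N : Lam n}
    {B : ITy} (hAs : IsInter enum As) (d : Der enum (ext As Γ) M B) (e : DerI enum Γ N As) :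
    ∃ d' : Der enum Γ (M.inst N) B, Simulates (Der.app (Der.lam hAs d) e) d' := by
  obtain ⟨T, O, hF, hg⟩ := e.exists_family
  obtain ⟨d', σ, hσ, hd'⟩ := d.exists_subst 0 Γ (fun i => by simp) (ext N Lam.var)
    (fun i => by simp) T O hF
  have hl := d.occ_lt 0
  rw [ext_zero] at hl
  have hl' : ∀ j ∈ d.occ 0, j < (trList As).length := by simpa [trList_eq_map] using hl
  obtain ⟨μ, hμ, hc⟩ := hF.covBag e.hasType hg (d.occ 0) hl
  have hf := ground_hasTy (trList As) (d.occ 0) hl'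
  have hd := d.hasType
  have hq := hF.hasBagType (d.occ 0) hl
  rw [d.ctx_lam] at hd hd'
  have hσ' : CMor.Occ Γ (fun i => d.occ i.succ ++ occOf O (d.occ 0) i) d'.occ σ := hσ
  have hμ' := (CMor.Occ.id Γ (fun i => d.occ i.succ)).tensor hμ
  refine ⟨d', ?_⟩
  -- An exponential root step requires an annotation other than an identity. In the identity case
  -- the redex is already linear, and the linear step performs the trivial action on the bag itself.
  by_cases hid : ground (trList As) (d.occ 0) = idL (trList As)
  · have hα : d.occ 0 = List.range (trList As).length := by
      rw [idL_eq_ground] at hid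
      exact ground_injective _ _ _ hid
    have hp : IsPerm (ground (trList As) (d.occ 0)) (trList As) (reindex (trList As) (d.occ 0)) :=
      ⟨d.occ 0, by rw [hα], rfl, rfl⟩
    have hL := LinRoot.mk hd hp e.hasType hc hd'
    have hA := (Der.app (Der.lam hAs d) e).hasType
    have := Step.root (R := LinRoot) hL
    refine ⟨_, _, _, _, hA, CMor.Occ.id Γ _, hσ'.comp hμ', .refl, ?_⟩
    rw [← Der.ctx_eq, Der.ctx_app]
    exact this
  -- The body is unchanged by `HasType.contra_ground`, and the annotation becomes the label through
  -- which `Step.appL` acts on the bag.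
  · have hE := ExpRoot.mk hd hf hid (hd.contra_ground
      (CMor.IsGround.ext ⟨d.occ 0, hl', rfl, rfl⟩ (CMor.IsGround.id _))) hd
    have hE' := Step.appL (Step.root hE) e.hasType hc
    have hqc := hq.cov_id
    have hL := LinRoot.mk hd (IsPerm.id _) hq hqc hd'
    refine ⟨fun i => d.occ i.succ ++ occOf O (d.occ 0) i,
      Tm.app (Tm.lam (idL (reindex (trList As) (d.occ 0))) d.coarse) (bagOf T (d.occ 0)), _, _,
      ?_, hμ', hσ'.comp (((CMor.Occ.id Γ (fun i => d.occ i.succ))).tensor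
        (CMor.Occ.id Γ (occOf O (d.occ 0)))), .step ?_, ?_⟩
    · rw [occCtx_append]
      exact .app (.lam hd (idL_hasTy _)) hq
    · rw [occCtx_append, Der.ctx_app]
      exact hE'
    · rw [occCtx_append]
      exact Step.root hL

theorem Beta.exists_simulation {M N : Lam n} (h : Beta M N) :
    ∀ {Γ : Fin n → List ITy} {A : ITy} (d : Der enum Γ M A), (∀ i, IsInter enum (Γ i)) →
      ∃ d' : Der enum Γ N A, Simulates d d' := by
  induction h with
  | beta M N =>
    intro Γ A d hΓ
    cases d with
    | app d e =>
      cases d with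
      | lam hAs d => exact Simulates.beta hAs d e
  | lam h ih =>
    intro Γ A d hΓ
    cases d with
    | lam hAs d =>
      obtain ⟨d', h'⟩ := ih d fun i => Fin.cases hAs hΓ i
      exact ⟨_, h'.lam hAs⟩
  | appL h ih =>
    intro Γ A d hΓ
    cases d with
    | app d e =>
      obtain ⟨d', h'⟩ := ih d hΓ
      exact ⟨_, h'.appL e⟩
  | appR h ih =>
    intro Γ A d hΓ
    cases d with
    | app d e =>
      cases d.isIdem hΓ with
      | arr hAs _ _ _ => exact Simulates.appR d e hAs fun A d => ih d hΓ

theorem CMor.Occ.comp_cart {Γ : Fin n → List ITy} {M N : Lam n} {A B : ITy} {d : Der enum Γ M A}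
    {d' : Der enum Γ N B} {θ : CMor n} (h : CMor.Occ Γ d.occ d'.occ θ) : θ.comp d.cart = d'.cart :=
  funext fun i => (h i).comp_ground

theorem coarse_simulation {Γ : Fin n → List ITy} {M N : Lam n} {A : ITy} (d : Der enum Γ M A)
    (hΓ : ∀ i, IsInter enum (Γ i)) (h : Beta M N) :
    ∃ (d' : Der enum Γ N A) (t₁ t₂ : Tm n) (δ₁ δ₂ : Ctx n) (ν ν' σ : CMor n),
      HasType δ₁ t₁ (trTy A) ∧ HasType δ₂ t₂ (trTy A) ∧
      ν.IsGround d.ctx δ₁ ∧ ν'.IsGround δ₁ δ₂ ∧ σ.IsPerm δ₂ d'.ctx ∧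
      ExpStepOpt n d.ctx d.coarse (trTy A) ν (idM (trTy A)) δ₁ t₁ (trTy A) ∧
      LinStep n δ₁ t₁ (trTy A) ν' (idM (trTy A)) δ₂ t₂ (trTy A) ∧
      Iso δ₂ t₂ (trTy A) σ d'.ctx d'.coarse ∧
      ((σ.comp ν').comp ν).comp d.cart = d'.cart := by
  obtain ⟨d', o, t, ν, ν', ht, h₁, h₂, h₃, h₄⟩ := h.exists_simulation d hΓ
  -- The linear step lands exactly on `d'.coarse`, so the isomorphism is the identity permutation.
  have hid : (idC d'.ctx).IsPerm d'.ctx d'.ctx := fun i => IsPerm.id (d'.ctx i)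
  exact ⟨d', t, d'.coarse, _, d'.ctx, ν, ν', idC d'.ctx, ht, d'.hasType, h₁.isGround, h₂.isGround,
    hid, h₃, h₄, .perm d'.hasType d'.hasType hid,
    (((CMor.Occ.id Γ d'.occ).comp h₂).comp h₁).comp_cart⟩

/-! ### Substitution in λ-terms -/

/-- The substitution `σ` under a binder. -/
def liftSub {m : ℕ} (σ : Fin n → Lam m) : Fin (n + 1) → Lam (m + 1) :=
  ext (Lam.var 0) fun i => (σ i).rename Fin.succ

@[simp] theorem liftSub_zero {m : ℕ} (σ : Fin n → Lam m) : liftSub σ 0 = Lam.var 0 := rfl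

@[simp] theorem liftSub_succ {m : ℕ} (σ : Fin n → Lam m) (i : Fin n) :
    liftSub σ i.succ = (σ i).rename Fin.succ := rfl

@[simp] theorem liftRen_succ {m : ℕ} (ρ : Fin n → Fin m) (i : Fin n) :
    liftRen ρ i.succ = (ρ i).succ := rfl

theorem Lam.subst_lam {m : ℕ} (M : Lam (n + 1)) (σ : Fin n → Lam m) :
    (Lam.lam M).subst σ = Lam.lam (M.subst (liftSub σ)) := rfl

theorem Lam.rename_subst : ∀ {n : ℕ} (M : Lam n) {m l : ℕ} (ρ : Fin n → Fin m) (σ : Fin m → Lam l),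
    (M.rename ρ).subst σ = M.subst fun i => σ (ρ i)
  | _, Lam.var i, _, _, ρ, σ => rfl
  | _, Lam.lam M, _, _, ρ, σ => by
      rw [Lam.rename, Lam.subst_lam, Lam.rename_subst M, Lam.subst_lam]
      congr 2
      funext i
      refine Fin.cases rfl (fun i => rfl) i
  | _, Lam.app M N, _, _, ρ, σ => by
      rw [Lam.rename, Lam.subst, Lam.rename_subst M, Lam.rename_subst N, Lam.subst]

theorem Lam.rename_rename : ∀ {n : ℕ} (M : Lam n) {m l : ℕ} (ρ : Fin n → Fin m)
    (π : Fin m → Fin l), (M.rename ρ).rename π = M.rename fun i => π (ρ i)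
  | _, Lam.var i, _, _, ρ, σ => rfl
  | _, Lam.lam M, _, _, ρ, σ => by
      rw [Lam.rename, Lam.rename, Lam.rename_rename M, Lam.rename]
      congr 2
      funext i
      refine Fin.cases rfl (fun i => rfl) i
  | _, Lam.app M N, _, _, ρ, σ => by
      rw [Lam.rename, Lam.rename, Lam.rename_rename M, Lam.rename_rename N, Lam.rename]

theorem Lam.subst_rename : ∀ {n : ℕ} (M : Lam n) {m l : ℕ} (σ : Fin n → Lam m) (ρ : Fin m → Fin l),
    (M.subst σ).rename ρ = M.subst fun i => (σ i).rename ρ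
  | _, Lam.var i, _, _, σ, ρ => rfl
  | _, Lam.lam M, _, _, σ, ρ => by
      rw [Lam.subst_lam, Lam.rename, Lam.subst_rename M, Lam.subst_lam]
      congr 2
      funext i
      refine Fin.cases rfl (fun i => ?_) i
      simp [Lam.rename_rename]
  | _, Lam.app M N, _, _, σ, ρ => by
      rw [Lam.subst, Lam.rename, Lam.subst_rename M, Lam.subst_rename N, Lam.subst]

theorem Lam.subst_subst : ∀ {n : ℕ} (M : Lam n) {m l : ℕ} (σ : Fin n → Lam m) (τ : Fin m → Lam l),
    (M.subst σ).subst τ = M.subst fun i => (σ i).subst τ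
  | _, Lam.var i, _, _, σ, ρ => rfl
  | _, Lam.lam M, _, _, σ, τ => by
      rw [Lam.subst_lam, Lam.subst_lam, Lam.subst_subst M, Lam.subst_lam]
      congr 2
      funext i
      refine Fin.cases rfl (fun i => ?_) i
      simp [Lam.rename_subst, Lam.subst_rename]
  | _, Lam.app M N, _, _, σ, τ => by
      rw [Lam.subst, Lam.subst, Lam.subst_subst M, Lam.subst_subst N, Lam.subst]

theorem Lam.subst_var : ∀ {n : ℕ} (M : Lam n), M.subst Lam.var = M
  | _, Lam.var i => rfl
  | n, Lam.lam M => by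
      rw [Lam.subst_lam]
      have : liftSub (Lam.var (n := n)) = Lam.var := by
        funext i
        refine Fin.cases rfl (fun i => rfl) i
      rw [this, Lam.subst_var M]
  | _, Lam.app M N => by rw [Lam.subst, Lam.subst_var M, Lam.subst_var N]

theorem Lam.subst_liftSub_inst {m : ℕ} (M : Lam (n + 1)) (σ : Fin n → Lam m) (N : Lam m) :
    (M.subst (liftSub σ)).inst N = M.subst (ext N σ) := by
  rw [Lam.inst, Lam.subst_subst]
  congr 1
  funext i
  refine Fin.cases rfl (fun i => ?_) i
  rw [liftSub_succ, Lam.rename_subst]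
  exact Lam.subst_var _

theorem Lam.inst_subst {m : ℕ} (M : Lam (n + 1)) (N : Lam n) (σ : Fin n → Lam m) :
    (M.inst N).subst σ = (M.subst (liftSub σ)).inst (N.subst σ) := by
  rw [Lam.subst_liftSub_inst, Lam.inst, Lam.subst_subst]
  congr 1
  funext i
  refine Fin.cases rfl (fun i => rfl) i

theorem Beta.subst {M N : Lam n} (h : Beta M N) :
    ∀ {m : ℕ} (σ : Fin n → Lam m), Beta (M.subst σ) (N.subst σ) := by
  induction h with
  | beta M N =>
    intro m σ
    rw [Lam.inst_subst]
    exact .beta _ _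
  | lam _ ih => exact fun σ => .lam (ih _)
  | appL _ ih => exact fun σ => .appL (ih σ)
  | appR _ ih => exact fun σ => .appR (ih σ)

/-! ### Strong normalization -/

/-- Accessibility for β-reduction. -/
abbrev BetaAcc (M : Lam n) : Prop := Acc (fun N M : Lam n => Beta M N) M

theorem sn_iff_betaAcc (M : Lam n) : SN M ↔ BetaAcc M := by
  constructor
  · intro h
    by_contra hM
    obtain ⟨f, hf, hf'⟩ := (not_acc_iff_exists_descending_chain).1 hM
    exact h ⟨f, hf, hf'⟩
  · rintro h ⟨u, rfl, hu⟩
    exact not_acc_iff_exists_descending_chain.2 ⟨u, rfl, hu⟩ h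

theorem BetaAcc.of_map {m : ℕ} (f : Lam n → Lam m) (hf : ∀ M N, Beta M N → Beta (f M) (f N))
    {M : Lam n} (h : BetaAcc (f M)) : BetaAcc M :=
  Subrelation.accessible (r := InvImage (fun N M : Lam m => Beta M N) f) (fun h => hf _ _ h)
    (InvImage.accessible f h)

/-! ### Reducibility -/

/- Reducible terms of a type, over a fixed nonempty set of variables. -/
mutual
def Red {m : ℕ} : ITy → Lam (m + 1) → Prop
  | ITy.o, M => BetaAcc M
  | ITy.arr As B, M => ∀ N, BetaAcc N → RedAll As N → Red B (Lam.app M N)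
def RedAll {m : ℕ} : List ITy → Lam (m + 1) → Prop
  | [], _ => True
  | A :: As, M => Red A M ∧ RedAll As M
end

theorem redAll_iff {m : ℕ} (M : Lam (m + 1)) : ∀ As : List ITy, RedAll As M ↔ ∀ A ∈ As, Red A M
  | [] => by simp [RedAll]
  | A :: As => by simp [RedAll, redAll_iff M As]

/-- Terms that are not abstractions. -/
def Neutral (M : Lam n) : Prop := ∀ P, M ≠ Lam.lam P

mutual
-- The three reducibility conditions of Girard. At an arrow, the third is proved by induction on the
-- accessibility of the argument. `Red` demands this accessibility separately because the
-- intersection may be empty here.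
theorem red_props {m : ℕ} : ∀ A : ITy, (∀ M : Lam (m + 1), Red A M → BetaAcc M) ∧
    (∀ M N : Lam (m + 1), Red A M → Beta M N → Red A N) ∧
    ∀ M : Lam (m + 1), Neutral M → (∀ N, Beta M N → Red A N) → Red A M
  | ITy.o => by
      simp only [Red]
      exact ⟨fun M h => h, fun M N h hb => h.inv hb, fun M _ h => ⟨_, h⟩⟩
  | ITy.arr As B => by
      have ihA := redAll_var (m := m) As
      obtain ⟨ih₁, ih₂, ih₃⟩ := red_props (m := m) B
      have hv : BetaAcc (Lam.var (0 : Fin (m + 1))) := ⟨_, fun _ h => by cases h⟩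
      simp only [Red]
      refine ⟨fun M h => ?_, fun M N h hb P hP hP' => ih₂ _ _ (h P hP hP') (.appL hb), ?_⟩
      · exact BetaAcc.of_map (fun M => Lam.app M (Lam.var 0)) (fun _ _ => .appL)
          (ih₁ _ (h _ hv ihA.1))
      · intro M hM h N hN
        induction hN with
        | intro N hN ih =>
          intro hR
          refine ih₃ _ (fun P h => by cases h) fun P hP => ?_
          cases hP with
          | beta M N => exact absurd rfl (hM _)
          | appL hb => exact h _ hb N ⟨_, hN⟩ hR
          | appR hb => exact ih _ hb (ihA.2 _ _ hR hb)
-- What the arrow case needs about intersections. Accessibility is not among it, since the empty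
-- intersection does not imply it.
theorem redAll_var {m : ℕ} : ∀ As : List ITy, RedAll As (Lam.var (0 : Fin (m + 1))) ∧
    ∀ M N : Lam (m + 1), RedAll As M → Beta M N → RedAll As N
  | [] => by simp [RedAll]
  | A :: As => by
      obtain ⟨-, ih₂, ih₃⟩ := red_props (m := m) A
      obtain ⟨k₁, k₂⟩ := redAll_var (m := m) As
      simp only [RedAll]
      refine ⟨⟨ih₃ _ (fun P h => by cases h) (fun N h => by cases h), k₁⟩, fun M N h hb => ?_⟩
      exact ⟨ih₂ _ _ h.1 hb, k₂ _ _ h.2 hb⟩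
end

theorem red_var {m : ℕ} (A : ITy) (i : Fin (m + 1)) : Red A (Lam.var i) :=
  (red_props A).2.2 _ (fun P h => by cases h) fun N h => by cases h

/-- The redex is neutral, so it suffices that its reducts are reducible. Reducts inside the body or
the argument are handled by a double induction on accessibility, and the contractum by hypothesis.
-/
theorem red_beta {m : ℕ} {As : List ITy} {B : ITy} {M : Lam (m + 2)} (hM : BetaAcc M) :
    (∀ N, BetaAcc N → RedAll As N → Red B (M.inst N)) →
    ∀ N, BetaAcc N → RedAll As N → Red B (Lam.app (Lam.lam M) N) := by
  induction hM with
  | intro M hM ihM =>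
    intro h N hN
    induction hN with
    | intro N hN ihN =>
      intro hR
      refine (red_props B).2.2 _ (fun P h => by cases h) fun P hP => ?_
      cases hP with
      | beta M N => exact h N ⟨_, hN⟩ hR
      | appL hb =>
        cases hb with
        | lam hb =>
          exact ihM _ hb (fun N hN hR => (red_props B).2.1 _ _ (h N hN hR) (hb.subst _)) N
            ⟨_, hN⟩ hR
      | appR hb => exact ihN _ hb ((redAll_var As).2 _ _ hR hb)

/-! ### Typability -/

/-- Typability, without the information on the positions of the types of variables. -/
inductive Typ (enum : ITy → ℕ) : {n : ℕ} → (Fin n → List ITy) → Lam n → ITy → Prop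
  | var {n : ℕ} {Γ : Fin n → List ITy} {i : Fin n} {A : ITy} : A ∈ Γ i → Typ enum Γ (Lam.var i) A
  | lam {n : ℕ} {Γ : Fin n → List ITy} {As : List ITy} {M : Lam (n + 1)} {B : ITy} :
      IsInter enum As → Typ enum (ext As Γ) M B → Typ enum Γ (Lam.lam M) (ITy.arr As B)
  | app {n : ℕ} {Γ : Fin n → List ITy} {As : List ITy} {M N : Lam n} {B : ITy} :
      Typ enum Γ M (ITy.arr As B) → (∀ A ∈ As, Typ enum Γ N A) → Typ enum Γ (Lam.app M N) B

mutual
theorem Der.typ : ∀ {n : ℕ} {Γ : Fin n → List ITy} {M : Lam n} {A : ITy},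
    Der enum Γ M A → Typ enum Γ M A
  | _, _, _, _, .var _ _ h => .var (List.mem_of_getElem? h)
  | _, _, _, _, .lam hAs d => .lam hAs d.typ
  | _, _, _, _, .app d e => .app d.typ e.typ
theorem DerI.typ : ∀ {n : ℕ} {Γ : Fin n → List ITy} {M : Lam n} {As : List ITy},
    DerI enum Γ M As → ∀ A ∈ As, Typ enum Γ M A
  | _, _, _, _, .nil => by simp
  | _, _, _, _, .cons d e => by
      have h := d.typ
      have h' := e.typ
      simpa using ⟨h, h'⟩
end

theorem DerI.nonempty {Γ : Fin n → List ITy} {N : Lam n} : ∀ As : List ITy,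
    (∀ A ∈ As, Nonempty (Der enum Γ N A)) → Nonempty (DerI enum Γ N As)
  | [], _ => ⟨.nil⟩
  | A :: As, h =>
    have ⟨d⟩ := h A (by simp)
    have ⟨e⟩ := DerI.nonempty As fun A hA => h A (by simp [hA])
    ⟨.cons d e⟩

theorem Typ.nonempty_der {Γ : Fin n → List ITy} {M : Lam n} {A : ITy} (h : Typ enum Γ M A) :
    Nonempty (Der enum Γ M A) := by
  induction h with
  | var h =>
    obtain ⟨j, hj⟩ := List.mem_iff_getElem?.1 h
    exact ⟨.var _ j hj⟩
  | lam hAs _ ih => exact ih.map (.lam hAs)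
  | app _ _ ih₁ ih₂ =>
    obtain ⟨d⟩ := ih₁
    obtain ⟨e⟩ := DerI.nonempty _ ih₂
    exact ⟨.app d e⟩

theorem Typ.isIdem {Γ : Fin n → List ITy} {M : Lam n} {A : ITy} (h : Typ enum Γ M A)
    (hΓ : ∀ i, IsInter enum (Γ i)) : IsIdem enum A := by
  obtain ⟨d⟩ := h.nonempty_der
  exact d.isIdem hΓ

/-- The fundamental lemma of reducibility; the substitution is needed for the induction at
abstractions. -/
theorem Typ.red {Γ : Fin n → List ITy} {M : Lam n} {A : ITy} (h : Typ enum Γ M A) :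
    (∀ i, IsInter enum (Γ i)) → ∀ {m : ℕ} (σ : Fin n → Lam (m + 1)),
    (∀ i, ∀ B ∈ Γ i, Red B (σ i)) → Red A (M.subst σ) := by
  induction h with
  | var h => exact fun _ m σ hσ => hσ _ _ h
  | lam hAs _ ih =>
    intro hΓ m σ hσ
    rename_i Γ As M B _
    have key : ∀ N, BetaAcc N → RedAll As N → Red B ((M.subst (liftSub σ)).inst N) := by
      intro N _ hR
      rw [Lam.subst_liftSub_inst]
      refine ih (fun i => Fin.cases hAs hΓ i) _ fun i => ?_
      refine Fin.cases ?_ (fun i => ?_) i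
      · exact (redAll_iff N As).1 hR
      · exact hσ i
    -- Instantiating the body with a variable gives an accessible term; β-steps are stable under
    -- this instantiation, so the body itself is accessible.
    have h₀ := (red_props B).1 _ (key (Lam.var 0) ⟨_, fun _ h => by cases h⟩
      (redAll_var As).1)
    rw [Lam.subst_lam, Red]
    exact red_beta (BetaAcc.of_map (fun M => M.inst (Lam.var 0)) (fun _ _ h => h.subst _) h₀) key
  | app h₁ _ ih₁ ih₂ =>
    intro hΓ m σ hσ
    rename_i Γ As M N B _
    have h := ih₁ hΓ σ hσ
    rw [Red] at h
    have hN : ∀ A ∈ As, Red A (N.subst σ) := fun A hA => ih₂ A hA hΓ σ hσ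
    cases h₁.isIdem hΓ with
    | arr hAs _ _ _ =>
      -- Any one type of the argument shows that it is accessible; this is where nonempty
      -- intersections are indispensable.
      obtain ⟨A, hA⟩ := List.exists_mem_of_ne_nil As hAs
      exact h _ ((red_props A).1 _ (hN A hA)) ((redAll_iff _ As).2 hN)

theorem Typ.betaAcc {Γ : Fin n → List ITy} {M : Lam n} {A : ITy} (h : Typ enum Γ M A)
    (hΓ : ∀ i, IsInter enum (Γ i)) : BetaAcc M :=
  -- One variable is added because `Red` lives over a nonempty set of variables, and `n` may be `0`.
  BetaAcc.of_map (fun M => M.subst fun i => Lam.var i.castSucc) (fun _ _ h => h.subst _)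
    ((red_props A).1 _ (h.red hΓ _ fun i B _ => red_var B i.castSucc))

/-! ### Typability of strongly normalizing terms -/

theorem Typ.weaken {Γ : Fin n → List ITy} {M : Lam n} {A : ITy} (h : Typ enum Γ M A) :
    ∀ {Δ : Fin n → List ITy}, (∀ i, Γ i ⊆ Δ i) → Typ enum Δ M A := by
  induction h with
  | var h => exact fun hΔ => .var (hΔ _ h)
  | lam hAs _ ih =>
    exact fun hΔ => .lam hAs (ih fun i => Fin.cases (List.Subset.refl _) hΔ i)
  | app _ _ ih₁ ih₂ => exact fun hΔ => .app (ih₁ hΔ) fun A hA => ih₂ A hA hΔ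

/-- Typings of the argument found under a binder concern its weakening; this brings them back to the
outer context. -/
theorem Typ.of_rename : ∀ {n : ℕ} {M : Lam n} {m : ℕ} {ρ : Fin n → Fin m} {Δ : Fin m → List ITy}
    {A : ITy}, Typ enum Δ (M.rename ρ) A → ∀ {Γ : Fin n → List ITy}, (∀ i, Δ (ρ i) ⊆ Γ i) →
    Typ enum Γ M A
  | _, Lam.var i, _, ρ, Δ, A, h, Γ, hΓ => by
      rw [Lam.rename] at h
      cases h with
      | var h => exact .var (hΓ _ h)
  | _, Lam.lam M, _, ρ, Δ, A, h, Γ, hΓ => by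
      rw [Lam.rename] at h
      cases h with
      | lam hAs h =>
        exact .lam hAs (h.of_rename fun i => Fin.cases (List.Subset.refl _) hΓ i)
  | _, Lam.app M N, _, ρ, Δ, A, h, Γ, hΓ => by
      rw [Lam.rename] at h
      cases h with
      | app h h' => exact .app (h.of_rename hΓ) fun A hA => (h' A hA).of_rename hΓ

/-- The list `L` collects the types given to the copies of the argument in the typing of the
substituted term. It may be empty, when the variable does not occur. -/
theorem Typ.of_subst {n : ℕ} {P : Lam (n + 1)} {k : Fin (n + 1)} {τ : Fin (n + 1) → Lam n}
    (hτ : ∀ i, τ (k.succAbove i) = Lam.var i) {Γ : Fin n → List ITy} {A : ITy}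
    (h : Typ enum Γ (P.subst τ) A) :
    ∃ L : List ITy, (∀ B ∈ L, Typ enum Γ (τ k) B) ∧ ∀ Γ' : Fin (n + 1) → List ITy,
      (∀ i, Γ i ⊆ Γ' (k.succAbove i)) → L ⊆ Γ' k → Typ enum Γ' P A :=
  match P with
  | .var i => by
      rcases Fin.eq_self_or_eq_succAbove k i with rfl | ⟨i, rfl⟩
      · rw [Lam.subst] at h
        exact ⟨[A], by simpa using h, fun Γ' _ hL => .var (hL (by simp))⟩
      · rw [Lam.subst, hτ] at h
        cases h with
        | var h => exact ⟨[], by simp, fun Γ' hΓ _ => .var (hΓ _ h)⟩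
  | .lam P => by
      rw [Lam.subst_lam] at h
      cases h with
      | lam hAs h =>
        obtain ⟨L, h₁, h₂⟩ := Typ.of_subst (P := P) (k := k.succ) (subst_lift_succAbove hτ) h
        refine ⟨L, fun B hB => (h₁ B hB).of_rename fun i => List.Subset.refl _,
          fun Γ' hΓ hL => .lam hAs (h₂ _ (fun i => ?_) hL)⟩
        refine Fin.cases ?_ (fun i => ?_) i
        · rw [Fin.succ_succAbove_zero]
          exact List.Subset.refl _
        · rw [Fin.succ_succAbove_succ]
          exact hΓ i
  | .app P Q => by
      rw [Lam.subst] at h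
      cases h with
      | app h h' =>
        obtain ⟨L, h₁, h₂⟩ := Typ.of_subst (P := P) hτ h
        choose! L' k₁ k₂ using fun A hA => Typ.of_subst (P := Q) hτ (h' A hA)
        rename_i As
        refine ⟨L ++ As.flatMap L', ?_, fun Γ' hΓ hL => .app (h₂ Γ' hΓ ?_) fun A hA =>
          k₂ A hA Γ' hΓ ?_⟩
        · simp only [List.mem_append, List.mem_flatMap]
          rintro B (hB | ⟨A, hA, hB⟩)
          exacts [h₁ B hB, k₁ A hA B hB]
        · exact fun B hB => hL (by simp [hB])
        · intro B hB
          apply hL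
          simp only [List.mem_append, List.mem_flatMap]
          exact .inr ⟨A, hA, hB⟩

-- Sorted intersections and unions of contexts.

theorem exists_insert (henum : Function.Injective enum) (A : ITy) : ∀ As : List ITy,
    As.Pairwise (fun B C => enum B < enum C) →
    ∃ Bs : List ITy, Bs.Pairwise (fun B C => enum B < enum C) ∧ ∀ B, B ∈ Bs ↔ B = A ∨ B ∈ As
  | [], _ => ⟨[A], by simp, by simp⟩
  | C :: As, h => by
      rw [List.pairwise_cons] at h
      rcases lt_trichotomy (enum A) (enum C) with hA | hA | hA
      · refine ⟨A :: C :: As, ?_, by simp⟩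
        simp only [List.pairwise_cons, List.mem_cons]
        refine ⟨?_, h⟩
        rintro B (rfl | hB)
        exacts [hA, hA.trans (h.1 B hB)]
      · obtain rfl := henum hA
        exact ⟨A :: As, List.pairwise_cons.2 h, by simp⟩
      · obtain ⟨Bs, h₁, h₂⟩ := exists_insert henum A As h.2
        refine ⟨C :: Bs, List.pairwise_cons.2 ⟨fun B hB => ?_, h₁⟩, fun B => ?_⟩
        · rcases (h₂ B).1 hB with rfl | hB
          exacts [hA, h.1 B hB]
        · simp only [List.mem_cons, h₂]
          tauto

theorem exists_isInter (henum : Function.Injective enum) {L : List ITy} (hL : L ≠ [])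
    (h : ∀ A ∈ L, IsIdem enum A) : ∃ As, IsInter enum As ∧ ∀ A, A ∈ As ↔ A ∈ L := by
  obtain ⟨As, h₁, h₂⟩ : ∃ As : List ITy, As.Pairwise (fun B C => enum B < enum C) ∧
      ∀ A, A ∈ As ↔ A ∈ L := by
    clear hL h
    induction L with
    | nil => exact ⟨[], by simp, by simp⟩
    | cons A L ih =>
      obtain ⟨As, h₁, h₂⟩ := ih
      obtain ⟨Bs, k₁, k₂⟩ := exists_insert henum A As h₁
      exact ⟨Bs, k₁, fun B => by rw [k₂, h₂, List.mem_cons]⟩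
  obtain ⟨A, hA⟩ := List.exists_mem_of_ne_nil L hL
  exact ⟨As, ⟨List.ne_nil_of_mem ((h₂ A).2 hA), fun B hB => h B ((h₂ B).1 hB), h₁⟩, h₂⟩

/-- Subterms are typed in unrelated contexts; weakening to the union puts them in a common one. -/
theorem exists_union (henum : Function.Injective enum) {Γ Δ : Fin n → List ITy}
    (hΓ : ∀ i, IsInter enum (Γ i)) (hΔ : ∀ i, IsInter enum (Δ i)) :
    ∃ Θ : Fin n → List ITy, (∀ i, IsInter enum (Θ i)) ∧ (∀ i, Γ i ⊆ Θ i) ∧ ∀ i, Δ i ⊆ Θ i := by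
  have h : ∀ i, ∃ As, IsInter enum As ∧ ∀ A, A ∈ As ↔ A ∈ Γ i ++ Δ i := by
    refine fun i => exists_isInter henum (List.append_ne_nil_of_left_ne_nil (hΓ i).1 _) ?_
    intro A hA
    exact (List.mem_append.1 hA).elim ((hΓ i).2.1 A) ((hΔ i).2.1 A)
  choose Θ h₁ h₂ using h
  exact ⟨Θ, h₁, fun i A hA => (h₂ i A).2 (List.mem_append_left _ hA),
    fun i A hA => (h₂ i A).2 (List.mem_append_right _ hA)⟩

theorem isInter_singleton {A : ITy} (h : IsIdem enum A) : IsInter enum [A] :=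
  ⟨by simp, by simpa using h, by simp⟩

/-- `WeakHead M M' Q`: `M` becomes `M'` by contraction of its head redex, whose argument is `Q`. -/
inductive WeakHead : Lam n → Lam n → Lam n → Prop
  | beta (P : Lam (n + 1)) (Q : Lam n) : WeakHead (Lam.app (Lam.lam P) Q) (P.inst Q) Q
  | app {M M' Q N : Lam n} : WeakHead M M' Q → WeakHead (Lam.app M N) (Lam.app M' N) Q

theorem WeakHead.to_beta {M M' Q : Lam n} (h : WeakHead M M' Q) : Beta M M' := by
  induction h with
  | beta P Q => exact .beta P Q
  | app _ ih => exact .appL ih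

/-- The binder receives the intersection of the types used by the copies of `Q`. If there are no
copies this would be empty, so the type `C` of `Q` is always included. -/
theorem WeakHead.expand (henum : Function.Injective enum) {M M' Q : Lam n} (h : WeakHead M M' Q)
    {Γ : Fin n → List ITy} (hΓ : ∀ i, IsInter enum (Γ i)) {C : ITy} (hC : Typ enum Γ Q C) :
    ∀ {A : ITy}, Typ enum Γ M' A → Typ enum Γ M A := by
  induction h with
  | beta P Q =>
    intro A hA
    obtain ⟨L, h₁, h₂⟩ := Typ.of_subst (P := P) (k := 0) (τ := ext Q Lam.var)
      (fun i => by simp) hA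
    have hL : ∀ B ∈ C :: L, Typ enum Γ Q B := by
      simp only [List.mem_cons]
      rintro B (rfl | hB)
      exacts [hC, h₁ B hB]
    obtain ⟨As, hAs, hm⟩ := exists_isInter henum (List.cons_ne_nil C L)
      fun B hB => (hL B hB).isIdem hΓ
    refine .app (As := As) (.lam hAs (h₂ _ (fun i => by simp) fun B hB => ?_)) fun B hB =>
      hL B ((hm B).1 hB)
    exact (hm B).2 (List.mem_cons_of_mem _ hB)
  | app _ ih =>
    intro A hA
    cases hA with
    | app h h' => exact .app (ih hC h) h'

/-- Terms `x N₁ … Nₖ`. -/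
inductive Spine : Lam n → Prop
  | var (i : Fin n) : Spine (Lam.var i)
  | app {M N : Lam n} : Spine M → Spine (Lam.app M N)

theorem head_cases : ∀ {n : ℕ} (M : Lam n),
    Spine M ∨ (∃ P, M = Lam.lam P) ∨ ∃ M' Q, WeakHead M M' Q
  | _, Lam.var i => .inl (.var i)
  | _, Lam.lam P => .inr (.inl ⟨P, rfl⟩)
  | _, Lam.app M N => by
      rcases head_cases M with h | ⟨P, rfl⟩ | ⟨M', Q, h⟩
      · exact .inl h.app
      · exact .inr (.inr ⟨_, _, .beta P N⟩)
      · exact .inr (.inr ⟨_, _, h.app⟩)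

/-- Subterms. -/
inductive Subterm : {m n : ℕ} → Lam m → Lam n → Prop
  | refl {n : ℕ} {M : Lam n} : Subterm M M
  | lam {m n : ℕ} {S : Lam m} {M : Lam (n + 1)} : Subterm S M → Subterm S (Lam.lam M)
  | appL {m n : ℕ} {S : Lam m} {M N : Lam n} : Subterm S M → Subterm S (Lam.app M N)
  | appR {m n : ℕ} {S : Lam m} {M N : Lam n} : Subterm S N → Subterm S (Lam.app M N)

theorem Subterm.trans {l m n : ℕ} {R : Lam l} {S : Lam m} {M : Lam n} (h : Subterm S M) :
    Subterm R S → Subterm R M := by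
  induction h with
  | refl => exact id
  | lam _ ih => exact fun h => .lam (ih h)
  | appL _ ih => exact fun h => .appL (ih h)
  | appR _ ih => exact fun h => .appR (ih h)

theorem Subterm.exists_beta {m n : ℕ} {S : Lam m} {M : Lam n} (h : Subterm S M) :
    ∀ {S' : Lam m}, Beta S S' → ∃ M', Beta M M' ∧ Subterm S' M' := by
  induction h with
  | refl => exact fun h => ⟨_, h, .refl⟩
  | lam _ ih =>
    intro S' h
    obtain ⟨M', h₁, h₂⟩ := ih h
    exact ⟨_, .lam h₁, .lam h₂⟩
  | appL _ ih =>
    intro S' h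
    obtain ⟨M', h₁, h₂⟩ := ih h
    exact ⟨_, .appL h₁, .appL h₂⟩
  | appR _ ih =>
    intro S' h
    obtain ⟨M', h₁, h₂⟩ := ih h
    exact ⟨_, .appR h₁, .appR h₂⟩

/-- Terms that have a type in some context. -/
def Typable (enum : ITy → ℕ) (M : Lam n) : Prop :=
  ∃ (Γ : Fin n → List ITy) (A : ITy), (∀ i, IsInter enum (Γ i)) ∧ Typ enum Γ M A

theorem exists_typ_var (i : Fin n) {A : ITy} (hA : IsIdem enum A) :
    ∃ Γ : Fin n → List ITy, (∀ i, IsInter enum (Γ i)) ∧ Typ enum Γ (Lam.var i) A :=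
  ⟨fun _ => [A], fun _ => isInter_singleton hA, .var (by simp)⟩

theorem BetaAcc.typable_subterm (henum : Function.Injective enum) {n : ℕ} {M : Lam n}
    (hM : BetaAcc M) : ∀ {m : ℕ} {S : Lam m}, Subterm S M → Typable enum S := by
  induction hM with
  | intro M hM ihM =>
    -- A reduct of a subterm is a subterm of a reduct of `M`, so the induction on accessibility
    -- applies to it.
    have hred : ∀ {m : ℕ} {S S' : Lam m}, Subterm S M → Beta S S' → Typable enum S' := by
      intro m S S' hS hb
      obtain ⟨M', h₁, h₂⟩ := hS.exists_beta hb
      exact ihM M' h₁ h₂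
    -- Two strengthenings of typability make the structural induction work: a spine can be given any
    -- idempotent type, so that its head variable can accept one more argument, and the argument of
    -- the head redex, buried in the function part, is itself typable.
    have key : ∀ {m : ℕ} (S : Lam m), Subterm S M → Typable enum S ∧
        (Spine S → ∀ A, IsIdem enum A → ∃ Γ : Fin m → List ITy, (∀ i, IsInter enum (Γ i)) ∧
          Typ enum Γ S A) ∧ ∀ S' Q, WeakHead S S' Q → Typable enum Q := by
      intro m S
      induction S with
      | var i =>
        intro _
        obtain ⟨Γ, h₁, h₂⟩ := exists_typ_var i (IsIdem.o (enum := enum))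
        exact ⟨⟨Γ, _, h₁, h₂⟩, fun _ A hA => exists_typ_var i hA, fun _ _ h => by cases h⟩
      | lam P ih =>
        intro hS
        obtain ⟨⟨Γ, A, h₁, h₂⟩, -⟩ := ih (hS.trans (.lam .refl))
        refine ⟨⟨fun i => Γ i.succ, ITy.arr (Γ 0) A, fun i => h₁ i.succ, .lam (h₁ 0) ?_⟩, (fun h => by cases h),
          fun _ _ h => by cases h⟩
        rwa [ext_eta]
      | app S₁ S₂ ih₁ ih₂ =>
        intro hS
        obtain ⟨-, h₁, h₁'⟩ := ih₁ (hS.trans (.appL .refl))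
        obtain ⟨h₂, -, -⟩ := ih₂ (hS.trans (.appR .refl))
        have hspine : Spine (Lam.app S₁ S₂) → ∀ A, IsIdem enum A → ∃ Γ : Fin _ → List ITy,
            (∀ i, IsInter enum (Γ i)) ∧ Typ enum Γ (Lam.app S₁ S₂) A := by
          intro h A hA
          cases h with
          | app h =>
            obtain ⟨Γ, C, hΓ, hC⟩ := h₂
            have hi := isInter_singleton (hC.isIdem hΓ)
            -- The shorter spine is asked for a function type whose domain is the type `C` already
            -- found for its next argument.
            obtain ⟨Δ, hΔ, hA'⟩ := h₁ h (ITy.arr [C] A) (.arr hi.1 hi.2.1 hi.2.2 hA)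
            obtain ⟨Θ, hΘ, k₁, k₂⟩ := exists_union henum hΓ hΔ
            refine ⟨Θ, hΘ, .app (hA'.weaken k₂) fun B hB => ?_⟩
            obtain rfl : B = C := by simpa using hB
            exact hC.weaken k₁
        have hhead : ∀ S' Q, WeakHead (Lam.app S₁ S₂) S' Q → Typable enum Q := by
          intro S' Q h
          cases h with
          | beta => exact h₂
          | app h => exact h₁' _ _ h
        refine ⟨?_, hspine, hhead⟩
        rcases head_cases (Lam.app S₁ S₂) with h | ⟨P, h⟩ | ⟨S', Q, h⟩
        · obtain ⟨Γ, hΓ, h⟩ := hspine h ITy.o .o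
          exact ⟨Γ, _, hΓ, h⟩
        · cases h
        · obtain ⟨Γ, C, hΓ, hC⟩ := hhead S' Q h
          obtain ⟨Δ, A, hΔ, hA⟩ := hred hS h.to_beta
          obtain ⟨Θ, hΘ, k₁, k₂⟩ := exists_union henum hΓ hΔ
          exact ⟨Θ, A, hΘ, h.expand henum hΘ (hC.weaken k₁) (hA.weaken k₂)⟩
    exact fun {m S} hS => (key S hS).1

end StructRes

theorem mainTheorem7 (enum : ITy → ℕ) (henum : Function.Injective enum) :
    (∀ (n : ℕ) (Γ : Fin n → List ITy) (M : Lam n) (A : ITy) (d : Der enum Γ M A),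
      (∀ i, IsInter enum (Γ i)) →
      HasType d.ctx d.coarse (trTy A) ∧ d.cart.HasTy (fun i => trList (Γ i)) d.ctx ∧
        Approx d.coarse M) ∧
    (∀ (n : ℕ) (Γ : Fin n → List ITy) (M N : Lam n) (A : ITy) (d : Der enum Γ M A),
      (∀ i, IsInter enum (Γ i)) → Beta M N →
      ∃ (d' : Der enum Γ N A) (t₁ t₂ : Tm n) (δ₁ δ₂ : Ctx n) (ν ν' σ : CMor n),
        HasType δ₁ t₁ (trTy A) ∧ HasType δ₂ t₂ (trTy A) ∧
        ν.IsGround d.ctx δ₁ ∧ ν'.IsGround δ₁ δ₂ ∧ σ.IsPerm δ₂ d'.ctx ∧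
        ExpStepOpt n d.ctx d.coarse (trTy A) ν (idM (trTy A)) δ₁ t₁ (trTy A) ∧
        LinStep n δ₁ t₁ (trTy A) ν' (idM (trTy A)) δ₂ t₂ (trTy A) ∧
        Iso δ₂ t₂ (trTy A) σ d'.ctx d'.coarse ∧
        ((σ.comp ν').comp ν).comp d.cart = d'.cart) ∧
    (∀ (n : ℕ) (Γ : Fin n → List ITy) (M : Lam n) (A : ITy),
      (∀ i, IsInter enum (Γ i)) → Nonempty (Der enum Γ M A) → SN M) ∧
    (∀ (n : ℕ) (M : Lam n), SN M →
      ∃ (Γ : Fin n → List ITy) (A : ITy) (d : Der enum Γ M A),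
        (∀ i, IsInter enum (Γ i)) ∧ IsIdem enum A ∧
        HasType d.ctx d.coarse (trTy A) ∧ Approx d.coarse M) := by
  refine ⟨fun n Γ M A d _ => ⟨d.hasType, fun i => (d.cart_isGround i).hasTy, d.approx⟩,
    fun n Γ M N A d hΓ h => coarse_simulation d hΓ h,
    fun n Γ M A hΓ ⟨d⟩ => (sn_iff_betaAcc M).2 (d.typ.betaAcc hΓ), fun n M hM => ?_⟩
  obtain ⟨Γ, A, hΓ, h⟩ := ((sn_iff_betaAcc M).1 hM).typable_subterm henum .refl
  obtain ⟨d⟩ := h.nonempty_der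
  exact ⟨Γ, A, d, hΓ, d.isIdem hΓ, d.hasType, d.approx⟩
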